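/- **Setting.** Let $f:\mathbb{R}^n\to\mathbb{R}$ be $C^2$ and bounded below, $f^*=\inf f$, and let $\nabla f$ be Lipschitz with constant $L>0$. Let $d\le n$, let $m\ge 2$ be even, and let $\beta\in(0,1)$, $0<c<1/2$, $M_1,M_2>0$. For a matrix $A$ with $n$ rows and columns $Ae_i$, and $\varepsilon>0$, put $$(\nabla_{A,\varepsilon}f(x))_i=\frac{f(x+\varepsilon Ae_i)-f(x-\varepsilon Ae_i)}{2\varepsilon}.$$ **Algorithm.** The input is $x_0\in\mathbb{R}^n$, a matrix $P_{-1}\in\mathbb{R}^{n\times m}$ with columns of norm $1$, and a symmetric $H_0\in\mathbb{R}^{m\times m}$ with $M_1I\preceq H_0\preceq M_2I$. Iteration $k=0,1,\dots$, with precision $\varepsilon_k>0$, does the following. 1. Sample $Q_k\in\mathbb{R}^{n\times d}$ with independent $N(0,1)$ entries, independently of the previous iterations. 2. Obtain $P_k$ from $P_{k-1}$ by deleting the first two columns and appending $x_k/\|x_k\|$ and $Q_k\nabla_{Q_k,\varepsilon_k}f(x_k)/\|Q_k\nabla_{Q_k,\varepsilon_k}f(x_k)\|$ (a column with zero denominator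 is $0$). 3. Put $q_k=\nabla_{P_k,\varepsilon_k}f(x_k)$ and $d_k=-H_kq_k$. 4. Let $\alpha_k=\beta^i$ for the first $i\ge0$ with $f(x_k+\beta^iP_kd_k)\le f(x_k)+c\beta^iq_k^\top d_k$; if there is no such $i$, let $\alpha_k=0$. Put $x_{k+1}=x_k+\alpha_kP_kd_k$. 5. With $s=\alpha_kd_k$ and $y=\nabla_{P_k,\varepsilon_k}f(x_{k+1})-\nabla_{P_k,\varepsilon_k}f(x_k)$, put $$\tilde H_{k+1}=\Big(I-\frac{sy^\top}{s^\top y}\Big)H_k\Big(I-\frac{ys^\top}{s^\top y}\Big)+\frac{ss^\top}{s^\top y}$$ ($\tilde H_{k+1}=H_k$ if $s^\top y=0$). Then $H_{k+1}$ is $\tilde H_{k+1}$ with its eigenvalues larger than $M_2$ replaced by $M_2$ and those smaller than $M_1$ replaced by $M_1$. **Constants.** Call $(\mathcal C_0,\mathcal C)$, with $\mathcal C_0,\mathcal C>0$, *admissible* if for all $n,d$ and every $Q\in\mathbb{R}^{n\times d}$ with independent $N(0,1)$ entries the following two bounds hold: - for all $x\in\mathbb{R}^n$ and $\epsilon\in(0,1)$,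 $(1-\epsilon)\|x\|^2\le\|d^{-1/2}Q^\top x\|^2\le(1+\epsilon)\|x\|^2$ with probability at least $1-2e^{-\mathcal C_0\epsilon^2d}$; - if $d\le n$, $\frac1d\|QQ^\top\|_{\rm op}\le\mathcal C\frac nd$ with probability at least $1-2e^{-d}$. Put $$p(\epsilon)=1-(2e^{-\mathcal C_0\epsilon^2d}+2e^{-d}),\qquad \bar\alpha=\min\Big(1,\frac{2\beta(1-2c)}{mM_2L}\Big),$$ $$K=\max\Big(\frac{4\sqrt d\,\mathcal Cn}{1-\epsilon},\frac{6\mathcal Cnm^2}{d}\Big(\frac{M_2}{M_1c}+1\Big)\Big)L,\qquad \kappa=\frac{c\bar\alpha M_1p(\epsilon)}{4}\Big(\frac{(1-\epsilon)d}{3\mathcal Cn}\Big)^2 .$$ **Theorem.** Admissible constants $(\mathcal C_0,\mathcal C)$ exist. For all admissible $(\mathcal C_0,\mathcal C)$, all inputs as above, and every $\epsilon\in(0,1)$ with $p(\epsilon)>0$: 1. If $\varepsilon_k=\varepsilon>0$ for all $k$, then for every $k\ge0$ the random variable $\min_{0\le j\le k}\|\nabla f(x_j)\|$ is integrable and $$\mathbb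 E\Big[\min_{0\le j\le k}\|\nabla f(x_j)\|\Big]\le\sqrt{\frac{1}{k+1}\,\kappa^{-1}(f(x_0)-f^*)+K^2\varepsilon^2}.$$ 2. If $\varepsilon_k>0$ and $\sum_k\varepsilon_k^2<\infty$, then for every $k\ge0$ the random variable $\min_{0\le j\le k}\|\nabla f(x_j)\|$ is integrable and $$\mathbb E\Big[\min_{0\le j\le k}\|\nabla f(x_j)\|\Big]\le\sqrt{\frac{1}{k+1}\,\kappa^{-1}(f(x_0)-f^*)+\frac{K^2\sum_{i\ge0}\varepsilon_i^2}{k+1}},$$ and hence $\mathbb E\big[\min_{0\le j\le k}\|\nabla f(x_j)\|\big]=O(\sqrt{1/k})$ as $k\to\infty$. -/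

import Mathlib

open scoped Matrix

noncomputable section

namespace SubspaceQN

open MeasureTheory ProbabilityTheory

/-- `ℝⁿ` with its Euclidean norm. -/
abbrev Vec (n : ℕ) := EuclideanSpace ℝ (Fin n)

/-- The matrix-vector product, on Euclidean vectors. -/
def mulE {n l : ℕ} (A : Matrix (Fin n) (Fin l) ℝ) (v : Vec l) : Vec n :=
  Matrix.toEuclideanLin A v

/-- The law of an `n × d` random matrix with independent standard normal entries. -/
def gaussianMatrix (n d : ℕ) : Measure (Fin n → Fin d → ℝ) :=
  Measure.pi fun _ => Measure.pi fun _ => gaussianReal 0 1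

/-- `C₀` and `C` are positive universal constants for the two concentration bounds for Gaussian
matrices: for all sizes, `(1-ϵ)‖x‖² ≤ ‖d^(-1/2) Qᵀ x‖² ≤ (1+ϵ)‖x‖²` holds with probability at least
`1 - 2 exp (-C₀ ϵ² d)`, and, when `d ≤ n`, `‖Q Qᵀ‖ / d ≤ C n / d` (operator norm) holds with
probability at least `1 - 2 exp (-d)`. -/
structure IsGaussianConstants (C₀ C : ℝ) : Prop where
  pos₀ : 0 < C₀
  pos : 0 < C
  vector : ∀ (n d : ℕ) (x : Vec n) (ϵ : ℝ), 0 < ϵ → ϵ < 1 →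
    1 - 2 * Real.exp (-C₀ * ϵ ^ 2 * d) ≤ (gaussianMatrix n d).real
      {Q | (1 - ϵ) * ‖x‖ ^ 2 ≤ ‖(1 / √(d : ℝ)) • mulE (Matrix.of Q)ᵀ x‖ ^ 2 ∧
        ‖(1 / √(d : ℝ)) • mulE (Matrix.of Q)ᵀ x‖ ^ 2 ≤ (1 + ϵ) * ‖x‖ ^ 2}
  operator : ∀ n d : ℕ, d ≤ n →
    1 - 2 * Real.exp (-(d : ℝ)) ≤ (gaussianMatrix n d).real
      {Q | 1 / (d : ℝ) * ‖Matrix.toEuclideanCLM (n := Fin n) (𝕜 := ℝ)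
        (Matrix.of Q * (Matrix.of Q)ᵀ)‖ ≤ C * ((n : ℝ) / d)}

/-- The central finite-difference approximation, with precision `ε`, of the gradient at `0` of
`v ↦ f (x + A v)`. -/
def fdGrad {n l : ℕ} (f : Vec n → ℝ) (A : Matrix (Fin n) (Fin l) ℝ) (ε : ℝ) (x : Vec n) : Vec l :=
  WithLp.toLp 2 fun i =>
    (f (x + ε • mulE A (EuclideanSpace.single i 1)) -
      f (x - ε • mulE A (EuclideanSpace.single i 1))) / (2 * ε)

/-- Delete the first two columns of `P` and append the two columns `u / ‖u‖` and `v / ‖v‖`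
(a column is `0` when the norm in its denominator is `0`). -/
def updateP {n m : ℕ} (P : Matrix (Fin n) (Fin m) ℝ) (u v : Vec n) : Matrix (Fin n) (Fin m) ℝ :=
  Matrix.of fun a j =>
    if h : (j : ℕ) + 2 < m then P a ⟨(j : ℕ) + 2, h⟩
    else if (j : ℕ) + 2 = m then ((‖u‖)⁻¹ • u) a
    else ((‖v‖)⁻¹ • v) a

/-- The Armijo condition at `x` for the step size `α` along `P v`, with approximate subspace
gradient `q`. -/
def Armijo {n m : ℕ} (f : Vec n → ℝ) (c : ℝ) (x : Vec n) (P : Matrix (Fin n) (Fin m) ℝ)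
    (v q : Vec m) (α : ℝ) : Prop :=
  f (x + α • mulE P v) ≤ f x + c * α * inner ℝ q v

open Classical in
/-- Backtracking line search: the first of `1, β, β², …` that satisfies the Armijo condition.
With inexact gradients there may be none; the step size is then `0`, the limit of the trial steps,
and the iterate stays where it is during this iteration. -/
def stepSize {n m : ℕ} (f : Vec n → ℝ) (β c : ℝ) (x : Vec n) (P : Matrix (Fin n) (Fin m) ℝ)
    (v q : Vec m) : ℝ :=
  if h : ∃ i : ℕ, Armijo f c x P v q (β ^ i) then β ^ Nat.find h else 0

/-- The BFGS formula for the inverse Hessian approximation. For `sᵀ y = 0`, where the formula is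
undefined, `H` is kept. -/
def bfgs {m : ℕ} (H : Matrix (Fin m) (Fin m) ℝ) (s y : Vec m) : Matrix (Fin m) (Fin m) ℝ :=
  (1 - (inner ℝ s y)⁻¹ • Matrix.vecMulVec s.ofLp y.ofLp) * H *
      (1 - (inner ℝ s y)⁻¹ • Matrix.vecMulVec y.ofLp s.ofLp) +
    (inner ℝ s y)⁻¹ • Matrix.vecMulVec s.ofLp s.ofLp

/-- Set the eigenvalues of a symmetric matrix that are larger than `M₂` or smaller than `M₁` to
`M₂` and `M₁`, respectively, keeping the eigenvectors (functional calculus). -/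
def modifyEig {m : ℕ} (M₁ M₂ : ℝ) (A : Matrix (Fin m) (Fin m) ℝ) : Matrix (Fin m) (Fin m) ℝ :=
  cfc (fun t : ℝ => max M₁ (min t M₂)) A

/-- The state of the algorithm at the beginning of an iteration: the iterate, the subspace matrix
of the previous iteration (the input matrix at the beginning), the inverse Hessian approximation. -/
structure State (n m : ℕ) where
  x : Vec n
  P : Matrix (Fin n) (Fin m) ℝ
  H : Matrix (Fin m) (Fin m) ℝ

/-- One iteration of the subspace quasi-Newton method with finite differences of precision `ε`,
where `Q` is the sampled random matrix. -/
def step {n m d : ℕ} (f : Vec n → ℝ) (β c M₁ M₂ ε : ℝ) (Q : Matrix (Fin n) (Fin d) ℝ)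
    (S : State n m) : State n m :=
  let P := updateP S.P S.x (mulE Q (fdGrad f Q ε S.x))
  let q := fdGrad f P ε S.x
  let v := -mulE S.H q
  let α := stepSize f β c S.x P v q
  let x' := S.x + α • mulE P v
  { x := x'
    P := P
    H := modifyEig M₁ M₂ (bfgs S.H (α • v) (fdGrad f P ε x' - fdGrad f P ε S.x)) }

/-- The run of the method from the input `S₀`, with precision `ε k` and sampled matrix `Q k` at
iteration `k`. -/
def run {n m d : ℕ} (f : Vec n → ℝ) (β c M₁ M₂ : ℝ) (S₀ : State n m) (ε : ℕ → ℝ)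
    (Q : ℕ → Matrix (Fin n) (Fin d) ℝ) : ℕ → State n m
  | 0 => S₀
  | k + 1 => step f β c M₁ M₂ (ε k) (Q k) (run f β c M₁ M₂ S₀ ε Q k)

/-- `min_{0 ≤ j ≤ k} ‖∇f(x_j)‖` along the run. -/
def minGrad {n m d : ℕ} (f : Vec n → ℝ) (β c M₁ M₂ : ℝ) (S₀ : State n m) (ε : ℕ → ℝ)
    (Q : ℕ → Matrix (Fin n) (Fin d) ℝ) (k : ℕ) : ℝ :=
  (Finset.range (k + 1)).inf' Finset.nonempty_range_add_one
    fun j => ‖gradient f (run f β c M₁ M₂ S₀ ε Q j).x‖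

/-- `p(ϵ) = 1 - (2 exp (-C₀ ϵ² d) + 2 exp (-d))`. -/
def successProb (C₀ ϵ : ℝ) (d : ℕ) : ℝ :=
  1 - (2 * Real.exp (-C₀ * ϵ ^ 2 * d) + 2 * Real.exp (-(d : ℝ)))

/-- `ᾱ = min (1, 2β(1-2c) / (m M₂ L))`. -/
def alphaBar (β c M₂ L : ℝ) (m : ℕ) : ℝ :=
  min 1 (2 * β * (1 - 2 * c) / (m * M₂ * L))

/-- `K = max (4 √d C n / (1-ϵ), (6 C n m² / d) (M₂ / (M₁ c) + 1)) L`. -/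
def biasConst (C ϵ c M₁ M₂ L : ℝ) (n m d : ℕ) : ℝ :=
  max (4 * √(d : ℝ) * C * n / (1 - ϵ)) (6 * C * n * (m : ℝ) ^ 2 / d * (M₂ / (M₁ * c) + 1)) * L

/-- `(c ᾱ M₁ p(ϵ) / 4) ((1-ϵ) d / (3 C n))²`. -/
def decreaseConst (C₀ C ϵ β c M₁ M₂ L : ℝ) (n m d : ℕ) : ℝ :=
  c * alphaBar β c M₂ L m * M₁ * successProb C₀ ϵ d / 4 * ((1 - ϵ) * d / (3 * C * n)) ^ 2

end SubspaceQN

end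

namespace SubspaceQN

open MeasureTheory ProbabilityTheory

/-! Let `g` be the gradient at the current iterate. Conditionally on that iterate, the fresh
Gaussian matrix `Q` captures `g` with probability at least half of `successProb`: `‖Qᵀ w‖² ≤ C n
‖w‖²` for all `w`, and `Qᵀ g` keeps a fixed fraction of its expected size
(`exists_captureSet_prob`). The last column of the new subspace matrix `P` is the normalized `Q h'`
with `h'` close to `Qᵀ g`, so it has a substantial inner product with `g` and `Pᵀ g` is not small.
While `‖g‖ > K ε`, the finite-difference error is small against `Pᵀ g` (`subspace_gradient_bounds`).
The Armijo condition then holds for all steps up to a fixed length (`fdGrad_lineSearch_le`), and `f`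
drops by a multiple of `‖g‖²`.

If `‖g‖ ≤ K ε`, or if the capture fails, it suffices that `f` never increases (`step_descent`). That
only needs `H` positive, so the BFGS update matters only through the spectral bounds that
`modifyEig` enforces.

Since the iterate is independent of the matrix sampled next, these facts integrate to an expected
decrease (`expected_decrease`). Telescoping, boundedness below and Jensen's inequality give
`expected_minGrad_le`, of which both cases of the theorem are instances.

As `ϵ` tends to `1`, the fraction `1 - ϵ` guaranteed by the vector bound vanishes, while the second
term of `biasConst` does not grow. An absolute small-ball estimate (`gaussianMatrix_small_ball`)
takes over there.

Admissible constants come from the exponential moments of `‖Q v‖²`: Chernoff's bound for a single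
vector, and integration over a ball of vectors for the operator norm. -/

/-! ### Gaussian matrices: laws, exponential moments, concentration for one vector. -/

lemma mulE_apply {n l : ℕ} (A : Matrix (Fin n) (Fin l) ℝ) (v : Vec l) (i : Fin n) :
    mulE A v i = ∑ j, A i j * v j := by
  simp [mulE, Matrix.mulVec, dotProduct]

instance (n d : ℕ) : IsProbabilityMeasure (gaussianMatrix n d) := by
  unfold gaussianMatrix; infer_instance

/-- A linear form of a standard Gaussian vector is Gaussian. -/
lemma map_sum_mul_pi_gaussianReal {n : ℕ} (v : Vec n) :
    (Measure.pi fun _ : Fin n => gaussianReal 0 1).map (fun z => ∑ i, z i * v i) =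
      gaussianReal 0 (‖v‖ ^ 2).toNNReal := by
  have h1 : (fun z : Fin n → ℝ => ∑ i, z i * v i) =
      (innerSL ℝ v) ∘ (WithLp.toLp 2) := by
    ext z
    simp [PiLp.inner_apply]
  rw [h1, ← Measure.map_map (by fun_prop) (by fun_prop), map_pi_eq_stdGaussian,
    IsGaussian.map_eq_gaussianReal, integral_strongDual_stdGaussian, variance_dual_stdGaussian,
    innerSL_apply_norm]

/-- The transpose of a Gaussian matrix is a Gaussian matrix. -/
lemma map_transpose_gaussianMatrix (n d : ℕ) :
    (gaussianMatrix n d).map (fun Q j i => Q i j) = gaussianMatrix d n := by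
  -- Flattened to a product over pairs of indices, transposition is a permutation of coordinates.
  have key : ∀ n d : ℕ, gaussianMatrix n d =
      (Measure.pi fun _ : Fin n × Fin d => gaussianReal 0 1).map
        (MeasurableEquiv.curry (Fin n) (Fin d) ℝ) := by
    intro n d
    have := Measure.infinitePi_map_curry (fun (_ : Fin n) (_ : Fin d) => gaussianReal 0 1)
    rw [Measure.infinitePi_eq_pi] at this
    simp_rw [Measure.infinitePi_eq_pi] at this
    exact this.symm
  have h2 := (measurePreserving_piCongrLeft
    (fun _ : Fin d × Fin n => gaussianReal 0 1) (Equiv.prodComm (Fin n) (Fin d))).map_eq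
  rw [key n d, key d n, ← h2, Measure.map_map (by fun_prop) (by fun_prop),
    Measure.map_map (by fun_prop) (by fun_prop)]
  congr 1

/-- Each coordinate of `Q v` is a linear form of a single row, and the rows are independent. -/
lemma map_mulE_gaussianMatrix (n d : ℕ) (v : Vec d) :
    (gaussianMatrix n d).map (fun Q i => mulE (Matrix.of Q) v i) =
      Measure.pi fun _ : Fin n => gaussianReal 0 (‖v‖ ^ 2).toNNReal := by
  have hm : Measurable fun z : Fin d → ℝ => ∑ i, z i * v i := by fun_prop
  have : IsProbabilityMeasure
      ((Measure.pi fun _ : Fin d => gaussianReal 0 1).map fun z => ∑ i, z i * v i) :=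
    Measure.isProbabilityMeasure_map hm.aemeasurable
  have := Measure.pi_map_pi (μ := fun _ : Fin n => Measure.pi fun _ : Fin d => gaussianReal 0 1)
    (f := fun _ z => ∑ i, z i * v i) (fun _ => hm.aemeasurable)
  simp_rw [map_sum_mul_pi_gaussianReal] at this
  rw [← this, gaussianMatrix]
  congr 1

/-- The exponential moments of the square of a centred Gaussian. -/
lemma lintegral_exp_sq_gaussianReal (v : NNReal) (s : ℝ) (hs : s * v < 1) :
    ∫⁻ y, ENNReal.ofReal (Real.exp (s / 2 * y ^ 2)) ∂(gaussianReal 0 v) =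
      ENNReal.ofReal (1 / √(1 - s * v)) := by
  by_cases hv : v = 0
  · subst hv
    simp [gaussianReal_zero_var]
  have hv' : (0 : ℝ) < v := by positivity
  -- The exponents `-y² / (2v)` of the density and `s y² / 2` add up to `-b y²`.
  set b : ℝ := (1 - s * v) / (2 * v) with hb
  have hbpos : 0 < b := by have : 0 < 1 - s * v := by linarith
                           positivity
  have e : ∀ y : ℝ, gaussianPDF 0 v y * ENNReal.ofReal (Real.exp (s / 2 * y ^ 2)) =
      ENNReal.ofReal ((√(2 * Real.pi * v))⁻¹ * Real.exp (-b * y ^ 2)) := by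
    intro y
    rw [gaussianPDF, ← ENNReal.ofReal_mul (gaussianPDFReal_nonneg _ _ _), gaussianPDFReal,
      mul_assoc, ← Real.exp_add]
    congr 3
    rw [hb]; field_simp; ring
  rw [gaussianReal_of_var_ne_zero 0 hv, lintegral_withDensity_eq_lintegral_mul _
    (measurable_gaussianPDF _ _) (by fun_prop)]
  simp only [Pi.mul_apply, e]
  rw [← ofReal_integral_eq_lintegral_ofReal
    ((integrable_exp_neg_mul_sq hbpos).const_mul _) (.of_forall fun y => by positivity),
    integral_const_mul, integral_gaussian]
  congr 1
  rw [← Real.sqrt_inv, ← Real.sqrt_mul (by positivity), ← Real.sqrt_one,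
    ← Real.sqrt_div (by norm_num), hb, Real.sqrt_one]
  congr 1
  have : 1 - s * v ≠ 0 := by linarith
  field_simp

lemma lintegral_exp_sum_sq_pi_gaussianReal (N : ℕ) (v : NNReal) (s : ℝ) (hs : s * v < 1) :
    ∫⁻ w, ENNReal.ofReal (Real.exp (s / 2 * ∑ j, w j ^ 2))
      ∂(Measure.pi fun _ : Fin N => gaussianReal 0 v) =
      ENNReal.ofReal ((1 / √(1 - s * v)) ^ N) := by
  have hi := iIndepFun_pi (μ := fun _ : Fin N => gaussianReal 0 v)
    (X := fun _ y => ENNReal.ofReal (Real.exp (s / 2 * y ^ 2))) (fun _ => by fun_prop)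
  have h := lintegral_prod_eq_prod_lintegral_of_indepFun Finset.univ _ hi (fun i => by fun_prop)
  have e : ∀ w : Fin N → ℝ, ENNReal.ofReal (Real.exp (s / 2 * ∑ j, w j ^ 2)) =
      ∏ j, ENNReal.ofReal (Real.exp (s / 2 * w j ^ 2)) := by
    intro w
    rw [← ENNReal.ofReal_prod_of_nonneg (fun _ _ => by positivity), ← Real.exp_sum,
      Finset.mul_sum]
  simp_rw [e]
  rw [h]
  have e2 : ∀ i : Fin N, ∫⁻ w, ENNReal.ofReal (Real.exp (s / 2 * w i ^ 2))
      ∂(Measure.pi fun _ : Fin N => gaussianReal 0 v) = ENNReal.ofReal (1 / √(1 - s * v)) := by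
    intro i
    rw [← lintegral_exp_sq_gaussianReal v s hs,
      ← (measurePreserving_eval (fun _ : Fin N => gaussianReal 0 v) i).lintegral_comp
        (by fun_prop)]
  simp_rw [e2]
  rw [Finset.prod_const, ENNReal.ofReal_pow (by positivity)]
  simp

lemma measurable_mulE_of {n d : ℕ} {α : Type*} [MeasurableSpace α] {A : α → Fin n → Fin d → ℝ}
    {v : α → Vec d} (hA : Measurable A) (hv : Measurable v) :
    Measurable fun a => mulE (Matrix.of (A a)) (v a) := by
  refine (WithLp.measurable_toLp 2 (Fin n → ℝ)).comp (f := fun a i => mulE (Matrix.of (A a)) (v a) i)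
    (measurable_pi_lambda _ fun i => ?_)
  simp_rw [mulE_apply]
  simp only [Matrix.of_apply]
  fun_prop

lemma measurable_mulE_transpose_of {n d : ℕ} {α : Type*} [MeasurableSpace α]
    {A : α → Fin n → Fin d → ℝ}
    {v : α → Vec n} (hA : Measurable A) (hv : Measurable v) :
    Measurable fun a => mulE (Matrix.of (A a))ᵀ (v a) :=
  measurable_mulE_of (A := fun a j i => A a i j) (by fun_prop) hv

lemma lintegral_exp_norm_sq_mulE (n d : ℕ) (v : Vec d) (s : ℝ) (hs : s * ‖v‖ ^ 2 < 1) :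
    ∫⁻ Q, ENNReal.ofReal (Real.exp (s / 2 * ‖mulE (Matrix.of Q) v‖ ^ 2)) ∂(gaussianMatrix n d) =
      ENNReal.ofReal ((1 / √(1 - s * ‖v‖ ^ 2)) ^ n) := by
  have h := lintegral_exp_sum_sq_pi_gaussianReal n (‖v‖ ^ 2).toNNReal s
    (by rwa [Real.coe_toNNReal _ (by positivity)])
  rw [← map_mulE_gaussianMatrix n d v, lintegral_map (by fun_prop),
    Real.coe_toNNReal _ (by positivity)] at h
  · simpa [EuclideanSpace.norm_sq_eq] using h
  · refine measurable_pi_lambda _ fun i => ?_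
    simp_rw [mulE_apply]
    fun_prop

lemma lintegral_exp_norm_sq_mulE_transpose (n d : ℕ) (x : Vec n) (s : ℝ)
    (hs : s * ‖x‖ ^ 2 < 1) :
    ∫⁻ Q, ENNReal.ofReal (Real.exp (s / 2 * ‖mulE (Matrix.of Q)ᵀ x‖ ^ 2)) ∂(gaussianMatrix n d) =
      ENNReal.ofReal ((1 / √(1 - s * ‖x‖ ^ 2)) ^ d) := by
  rw [← lintegral_exp_norm_sq_mulE d n x s hs, ← map_transpose_gaussianMatrix n d, lintegral_map]
  · rfl
  · exact ENNReal.measurable_ofReal.comp (Real.measurable_exp.comp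
      (((measurable_mulE_of measurable_id measurable_const).norm.pow_const 2).const_mul _))
  · fun_prop

/-- Chernoff bound, upper tail for `s > 0` and lower tail for `s < 0`. -/
lemma gaussianMatrix_norm_sq_tail (n d : ℕ) (x : Vec n) (s a : ℝ) (hs : s * ‖x‖ ^ 2 < 1) :
    (gaussianMatrix n d).real {Q | s * a ≤ s * ‖mulE (Matrix.of Q)ᵀ x‖ ^ 2} ≤
      Real.exp (-(s * a / 2)) * (1 / √(1 - s * ‖x‖ ^ 2)) ^ d := by
  have hm : Measurable fun Q : Fin n → Fin d → ℝ =>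
      ENNReal.ofReal (Real.exp (s / 2 * ‖mulE (Matrix.of Q)ᵀ x‖ ^ 2)) :=
    ENNReal.measurable_ofReal.comp (Real.measurable_exp.comp
      (((measurable_mulE_transpose_of measurable_id measurable_const).norm.pow_const 2).const_mul _))
  have h := meas_ge_le_lintegral_div (μ := gaussianMatrix n d) hm.aemeasurable
    (ε := ENNReal.ofReal (Real.exp (s * a / 2))) (by simp [Real.exp_pos]) (by simp)
  rw [lintegral_exp_norm_sq_mulE_transpose n d x s hs, ← ENNReal.ofReal_div_of_pos (by positivity)]
    at h
  refine (ENNReal.toReal_mono (by simp) ((measure_mono ?_).trans h)).trans ?_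
  · intro Q hQ
    simp only [Set.mem_ofPred_eq] at hQ ⊢
    refine ENNReal.ofReal_le_ofReal (Real.exp_le_exp.2 ?_)
    linarith
  · rw [ENNReal.toReal_ofReal (by positivity), Real.exp_neg, div_eq_inv_mul]

/-- One factor of the exponential moment, to second order; it follows from `1 - 1/t ≤ log t` at `t =
1 - σ`. -/
lemma one_div_sqrt_one_sub_le (σ : ℝ) (hσ : |σ| ≤ 1 / 2) :
    1 / √(1 - σ) ≤ Real.exp (σ / 2 + σ ^ 2) := by
  obtain ⟨h1, h2⟩ := abs_le.1 hσ
  have hp : 0 < 1 - σ := by linarith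
  have hl := Real.one_sub_inv_le_log_of_pos hp
  have h3 : (1 - σ)⁻¹ ≤ 1 + σ + 2 * σ ^ 2 := by
    rw [inv_le_iff_one_le_mul₀' hp]
    nlinarith [mul_nonneg (sq_nonneg σ) (by linarith : 0 ≤ 1 - 2 * σ)]
  rw [Real.sqrt_eq_rpow, Real.rpow_def_of_pos hp, one_div, ← Real.exp_neg, Real.exp_le_exp]
  linarith

lemma one_le_measureReal_add_of_univ_subset {α : Type*} [MeasurableSpace α] {μ : Measure α}
    [IsProbabilityMeasure μ] {G A : Set α} (h : Set.univ ⊆ G ∪ A) : 1 ≤ μ.real G + μ.real A := by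
  rw [← probReal_univ (μ := μ)]
  exact (measureReal_mono h).trans (measureReal_union_le _ _)

lemma norm_sq_one_div_sqrt_smul {n d : ℕ} (y : Vec n) :
    ‖(1 / √(d : ℝ)) • y‖ ^ 2 = ‖y‖ ^ 2 / d := by
  rw [norm_smul, mul_pow, Real.norm_of_nonneg (by positivity), div_pow, Real.sq_sqrt (by positivity)]
  ring

/-- Chernoff's bound for both tails with `s = σ / ‖x‖²` and `σ = ±ϵ/4`, so that `1 + 4σ` is `1 ± ϵ`.
The exponent divided by `d` is `-σ(1 + 4σ)/2 + σ/2 + σ² = -σ² = -ϵ²/16`. -/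
lemma gaussianMatrix_vector_concentration (n d : ℕ) (x : Vec n) (ϵ : ℝ) (h0 : 0 < ϵ) (h1 : ϵ < 1) :
    1 - 2 * Real.exp (-(1 / 16) * ϵ ^ 2 * d) ≤ (gaussianMatrix n d).real
      {Q | (1 - ϵ) * ‖x‖ ^ 2 ≤ ‖(1 / √(d : ℝ)) • mulE (Matrix.of Q)ᵀ x‖ ^ 2 ∧
        ‖(1 / √(d : ℝ)) • mulE (Matrix.of Q)ᵀ x‖ ^ 2 ≤ (1 + ϵ) * ‖x‖ ^ 2} := by
  simp_rw [norm_sq_one_div_sqrt_smul]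
  rcases Nat.eq_zero_or_pos d with rfl | hd
  · have := measureReal_nonneg (μ := gaussianMatrix n 0) (s := {Q | (1 - ϵ) * ‖x‖ ^ 2 ≤
      ‖mulE (Matrix.of Q)ᵀ x‖ ^ 2 / ((0 : ℕ) : ℝ) ∧
        ‖mulE (Matrix.of Q)ᵀ x‖ ^ 2 / ((0 : ℕ) : ℝ) ≤ (1 + ϵ) * ‖x‖ ^ 2})
    simp only [Nat.cast_zero, mul_zero, Real.exp_zero] at this ⊢
    linarith
  have hd' : (0 : ℝ) < d := by exact_mod_cast hd
  rcases eq_or_ne x 0 with rfl | hx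
  · have : mulE (n := d) (l := n) = fun A v => Matrix.toEuclideanLin A v := rfl
    simp only [this, map_zero, norm_zero]
    norm_num
    positivity
  have hx' : 0 < ‖x‖ ^ 2 := by positivity
  have tail : ∀ σ : ℝ, |σ| = ϵ / 4 → (gaussianMatrix n d).real
      {Q | σ / ‖x‖ ^ 2 * ((1 + 4 * σ) * (d * ‖x‖ ^ 2)) ≤
        σ / ‖x‖ ^ 2 * ‖mulE (Matrix.of Q)ᵀ x‖ ^ 2} ≤ Real.exp (-(1 / 16) * ϵ ^ 2 * d) := by
    intro σ hσ
    have hσ2 : σ ^ 2 = ϵ ^ 2 / 16 := by rw [← sq_abs, hσ]; ring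
    have e1 : σ / ‖x‖ ^ 2 * ‖x‖ ^ 2 = σ := by field_simp
    have := le_abs_self σ
    refine (gaussianMatrix_norm_sq_tail n d x _ _ (by rw [e1]; linarith)).trans ?_
    rw [e1]
    refine (mul_le_mul_of_nonneg_left (pow_le_pow_left₀ (by positivity)
      (one_div_sqrt_one_sub_le σ (by rw [hσ]; linarith)) d) (by positivity)).trans ?_
    rw [← Real.exp_nat_mul, ← Real.exp_add, Real.exp_le_exp]
    have : σ / ‖x‖ ^ 2 * ((1 + 4 * σ) * (d * ‖x‖ ^ 2)) = σ * (1 + 4 * σ) * d := by field_simp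
    rw [this]
    nlinarith
  have t1 := tail (ϵ / 4) (abs_of_pos (by positivity))
  have t2 := tail (-(ϵ / 4)) (by rw [abs_neg]; exact abs_of_pos (by positivity))
  have hu := one_le_measureReal_add_of_univ_subset (μ := gaussianMatrix n d)
    (G := {Q | (1 - ϵ) * ‖x‖ ^ 2 ≤ ‖mulE (Matrix.of Q)ᵀ x‖ ^ 2 / d ∧
        ‖mulE (Matrix.of Q)ᵀ x‖ ^ 2 / d ≤ (1 + ϵ) * ‖x‖ ^ 2})
    (A := {Q | ϵ / 4 / ‖x‖ ^ 2 * ((1 + 4 * (ϵ / 4)) * (d * ‖x‖ ^ 2)) ≤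
        ϵ / 4 / ‖x‖ ^ 2 * ‖mulE (Matrix.of Q)ᵀ x‖ ^ 2} ∪
        {Q | -(ϵ / 4) / ‖x‖ ^ 2 * ((1 + 4 * (-(ϵ / 4))) * (d * ‖x‖ ^ 2)) ≤
        -(ϵ / 4) / ‖x‖ ^ 2 * ‖mulE (Matrix.of Q)ᵀ x‖ ^ 2}) (by
      intro Q _
      simp only [Set.mem_union, Set.mem_ofPred_eq]
      by_contra! hcon
      obtain ⟨hG, hA, hB⟩ := hcon
      rw [mul_lt_mul_iff_of_pos_left (by positivity)] at hA
      rw [neg_div, neg_mul, neg_mul, neg_lt_neg_iff, mul_lt_mul_iff_of_pos_left (by positivity)]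
        at hB
      have := hG ((le_div_iff₀ hd').2 (by linarith))
      rw [lt_div_iff₀ hd'] at this
      linarith)
  have := measureReal_union_le (μ := gaussianMatrix n d)
    {Q | ϵ / 4 / ‖x‖ ^ 2 * ((1 + 4 * (ϵ / 4)) * (d * ‖x‖ ^ 2)) ≤
        ϵ / 4 / ‖x‖ ^ 2 * ‖mulE (Matrix.of Q)ᵀ x‖ ^ 2}
        {Q | -(ϵ / 4) / ‖x‖ ^ 2 * ((1 + 4 * (-(ϵ / 4))) * (d * ‖x‖ ^ 2)) ≤
        -(ϵ / 4) / ‖x‖ ^ 2 * ‖mulE (Matrix.of Q)ᵀ x‖ ^ 2}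
  linarith

/-! ### The operator norm of a Gaussian matrix. -/

lemma mulE_zero {n l : ℕ} (A : Matrix (Fin n) (Fin l) ℝ) : mulE A 0 = 0 := by
  simp [mulE]

lemma mulE_sub {n l : ℕ} (A : Matrix (Fin n) (Fin l) ℝ) (u v : Vec l) :
    mulE A (u - v) = mulE A u - mulE A v := by
  simp [mulE]

lemma mulE_smul {n l : ℕ} (A : Matrix (Fin n) (Fin l) ℝ) (r : ℝ) (v : Vec l) :
    mulE A (r • v) = r • mulE A v := by
  simp [mulE]

lemma mulE_mulE {n l k : ℕ} (A : Matrix (Fin n) (Fin l) ℝ) (B : Matrix (Fin l) (Fin k) ℝ)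
    (v : Vec k) : mulE A (mulE B v) = mulE (A * B) v := by
  simp [mulE]

lemma continuous_mulE {n l : ℕ} (A : Matrix (Fin n) (Fin l) ℝ) : Continuous (mulE A) :=
  (Matrix.toEuclideanLin A).continuous_of_finiteDimensional

lemma toEuclideanCLM_apply_eq_mulE {n : ℕ} (A : Matrix (Fin n) (Fin n) ℝ) (v : Vec n) :
    Matrix.toEuclideanCLM (n := Fin n) (𝕜 := ℝ) A v = mulE A v := by
  ext i
  simp [mulE]

lemma inner_mulE_transpose {n l : ℕ} (A : Matrix (Fin n) (Fin l) ℝ) (v : Vec l) (w : Vec n) :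
    inner ℝ v (mulE Aᵀ w) = inner ℝ (mulE A v) w := by
  simp only [PiLp.inner_apply, mulE_apply, RCLike.inner_apply, conj_trivial, Matrix.transpose_apply,
    Finset.sum_mul, Finset.mul_sum]
  rw [Finset.sum_comm]
  exact Finset.sum_congr rfl fun _ _ => Finset.sum_congr rfl fun _ _ => by ring

/-- A unit vector at which `‖A v‖` is the operator norm of `A`. -/
lemma exists_norm_mulE_max {n d : ℕ} (hd : 0 < d) (A : Matrix (Fin n) (Fin d) ℝ) :
    ∃ u : Vec d, ‖u‖ = 1 ∧ ∀ v, ‖mulE A v‖ ≤ ‖mulE A u‖ * ‖v‖ := by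
  have : Nonempty (Fin d) := ⟨⟨0, hd⟩⟩
  obtain ⟨u, hu, hmax⟩ := (isCompact_sphere (0 : Vec d) 1).exists_isMaxOn
    (NormedSpace.sphere_nonempty.2 zero_le_one) (f := fun v => ‖mulE A v‖)
    ((continuous_mulE A).norm.continuousOn)
  refine ⟨u, by simpa using hu, fun v => ?_⟩
  rcases eq_or_ne v 0 with rfl | hv
  · simp [mulE_zero]
  have hv' : 0 < ‖v‖ := norm_pos_iff.2 hv
  have h := hmax (show ‖v‖⁻¹ • v ∈ Metric.sphere (0 : Vec d) 1 by
    simp [norm_smul, hv'.ne'])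
  simp only [mulE_smul, norm_smul, norm_inv, norm_norm, Set.mem_ofPred_eq] at h
  rw [inv_mul_le_iff₀ hv'] at h
  linarith

/-- The operator norm of a Gaussian matrix; instead of a net, the exponential moment of `‖Q v‖ ^ 2`
is integrated over a ball that contains a ball about the maximizing unit vector. -/
lemma gaussianMatrix_operator_tail (n d : ℕ) (hd : 0 < d) (B : ℝ) :
    (gaussianMatrix n d).real {Q | ∃ u : Vec d, ‖u‖ = 1 ∧ B ≤ ‖mulE (Matrix.of Q) u‖ ^ 2} ≤
      Real.exp (-(B / 36)) * 3 ^ d * √2 ^ n := by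
  set γ := gaussianMatrix n d
  -- The radius `3/2` makes room for a ball of radius `1/2` about any unit vector. The parameter
  -- `2/9` keeps `2/9 * ‖v‖² < 1/2` on the large ball, so each moment is at most `√2 ^ n`.
  let F : (Fin n → Fin d → ℝ) → ENNReal := fun Q =>
    ∫⁻ v in Metric.ball (0 : Vec d) (3 / 2),
      ENNReal.ofReal (Real.exp (2 / 9 / 2 * ‖mulE (Matrix.of Q) v‖ ^ 2))
  have hmeas : Measurable (Function.uncurry fun (Q : Fin n → Fin d → ℝ) (v : Vec d) =>
      ENNReal.ofReal (Real.exp (2 / 9 / 2 * ‖mulE (Matrix.of Q) v‖ ^ 2))) :=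
    ENNReal.measurable_ofReal.comp (Real.measurable_exp.comp
      (((measurable_mulE_of measurable_fst measurable_snd).norm.pow_const 2).const_mul _))
  have hF : Measurable F := hmeas.lintegral_prod_right
  set V := volume (Metric.ball (0 : Vec d) 1)
  have hvol : ∀ (x : Vec d) (r : ℝ), 0 < r →
      volume (Metric.ball x r) = ENNReal.ofReal (r ^ d) * V := by
    intro x r hr
    rw [Measure.addHaar_ball_of_pos volume x hr]
    simp [V]
  have hVtop : V ≠ ⊤ := measure_ball_lt_top.ne
  have hV0 : V ≠ 0 := (Metric.measure_ball_pos volume _ one_pos).ne'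
  have hle : ∫⁻ Q, F Q ∂γ ≤ ENNReal.ofReal (√2 ^ n) * (ENNReal.ofReal ((3 / 2) ^ d) * V) := by
    rw [lintegral_lintegral_swap hmeas.aemeasurable, ← hvol 0 _ (by norm_num)]
    refine (setLIntegral_mono (g := fun _ => ENNReal.ofReal (√2 ^ n)) measurable_const
      fun v hv => ?_).trans (by rw [setLIntegral_const])
    have hv' : ‖v‖ < 3 / 2 := by simpa using hv
    have hv2 : ‖v‖ ^ 2 < 9 / 4 := by nlinarith [norm_nonneg v]
    rw [lintegral_exp_norm_sq_mulE n d v (2 / 9) (by linarith)]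
    refine ENNReal.ofReal_le_ofReal (pow_le_pow_left₀ (by positivity) ?_ n)
    rw [← Real.sqrt_one, ← Real.sqrt_div zero_le_one, Real.sqrt_one]
    refine Real.sqrt_le_sqrt ?_
    rw [div_le_iff₀ (by linarith)]
    linarith
  -- Within `1/2` of the maximizer `u`, `‖Q v‖ ≥ ‖Q u‖ - ‖Q (u - v)‖ ≥ ‖Q u‖ / 2`. The integrand is
  -- there at least `exp (1/9 * B/4)`.
  have hsub : {Q | ∃ u : Vec d, ‖u‖ = 1 ∧ B ≤ ‖mulE (Matrix.of Q) u‖ ^ 2} ⊆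
      {Q | ENNReal.ofReal (Real.exp (B / 36)) * (ENNReal.ofReal ((1 / 2) ^ d) * V) ≤ F Q} := by
    rintro Q ⟨u₀, hu₀, hB⟩
    obtain ⟨u, hu, hmax⟩ := exists_norm_mulE_max hd (Matrix.of Q)
    have hB' : B ≤ ‖mulE (Matrix.of Q) u‖ ^ 2 := by
      refine hB.trans (pow_le_pow_left₀ (norm_nonneg _) ?_ 2)
      simpa [hu₀] using hmax u₀
    have hball : Metric.ball u (1 / 2) ⊆ Metric.ball (0 : Vec d) (3 / 2) := by
      refine Metric.ball_subset_ball' ?_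
      rw [dist_zero_right, hu]; norm_num
    simp only [Set.mem_ofPred_eq]
    rw [← hvol u _ (by norm_num), ← setLIntegral_const]
    refine le_trans (setLIntegral_mono (hmeas.comp measurable_prodMk_left) fun v hv => ?_)
      (lintegral_mono_set hball)
    refine ENNReal.ofReal_le_ofReal (Real.exp_le_exp.2 ?_)
    have hv' : ‖u - v‖ < 1 / 2 := by simpa [dist_eq_norm, norm_sub_rev] using hv
    have h1 : ‖mulE (Matrix.of Q) u‖ - ‖mulE (Matrix.of Q) v‖ ≤ ‖mulE (Matrix.of Q) (u - v)‖ := by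
      rw [mulE_sub]; exact norm_sub_norm_le _ _
    have h2 := hmax (u - v)
    have h3 : ‖mulE (Matrix.of Q) u‖ / 2 ≤ ‖mulE (Matrix.of Q) v‖ := by
      nlinarith [norm_nonneg (mulE (Matrix.of Q) u)]
    have h4 := pow_le_pow_left₀ (by positivity) h3 2
    linarith
  have hmk := (mul_le_mul_right (measure_mono (μ := γ) hsub) _).trans
    ((mul_meas_ge_le_lintegral (μ := γ) hF _).trans hle)
  have hreal := ENNReal.toReal_mono (by finiteness) hmk
  simp only [ENNReal.toReal_mul] at hreal
  have hVpos : 0 < V.toReal := ENNReal.toReal_pos hV0 hVtop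
  rw [ENNReal.toReal_ofReal (by positivity), ENNReal.toReal_ofReal (by positivity),
    ENNReal.toReal_ofReal (by positivity), ENNReal.toReal_ofReal (by positivity)] at hreal
  -- The factor `3 ^ d` is the ratio of the volumes of the two balls.
  have h3 : (3 / 2 : ℝ) ^ d = 3 ^ d * (1 / 2) ^ d := by rw [← mul_pow]; norm_num
  rw [h3] at hreal
  have hpos : 0 < Real.exp (B / 36) * ((1 / 2) ^ d * V.toReal) := by positivity
  rw [← mul_le_mul_iff_right₀ hpos]
  refine hreal.trans (le_of_eq ?_)
  rw [Real.exp_neg]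
  field_simp

/-- A bound for `A` is a bound for `Aᵀ`. -/
lemma norm_sq_mulE_transpose_le {n d : ℕ} (A : Matrix (Fin n) (Fin d) ℝ) {B : ℝ}
    (hB : 0 ≤ B) (h : ∀ v, ‖mulE A v‖ ^ 2 ≤ B * ‖v‖ ^ 2) (w : Vec n) :
    ‖mulE Aᵀ w‖ ^ 2 ≤ B * ‖w‖ ^ 2 := by
  rcases (norm_nonneg (mulE Aᵀ w)).eq_or_lt with h0 | h0
  · rw [← h0, zero_pow two_ne_zero]; positivity
  have h3 : ‖mulE Aᵀ w‖ ^ 2 ≤ ‖mulE A (mulE Aᵀ w)‖ * ‖w‖ := by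
    rw [← real_inner_self_eq_norm_sq, inner_mulE_transpose]
    exact real_inner_le_norm _ _
  have h4 := pow_le_pow_left₀ (by positivity) h3 2
  have h5 := mul_le_mul_of_nonneg_right (h (mulE Aᵀ w)) (sq_nonneg ‖w‖)
  have h6 : ‖mulE Aᵀ w‖ ^ 2 * ‖mulE Aᵀ w‖ ^ 2 ≤ B * ‖w‖ ^ 2 * ‖mulE Aᵀ w‖ ^ 2 := by
    linarith
  exact le_of_mul_le_mul_right h6 (by positivity)

/-- A bound for `A` bounds the operator norm of `A Aᵀ`. -/
lemma norm_toEuclideanCLM_mul_transpose_le {n d : ℕ} (A : Matrix (Fin n) (Fin d) ℝ) {B : ℝ}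
    (hB : 0 ≤ B) (h : ∀ v, ‖mulE A v‖ ^ 2 ≤ B * ‖v‖ ^ 2) :
    ‖Matrix.toEuclideanCLM (n := Fin n) (𝕜 := ℝ) (A * Aᵀ)‖ ≤ B := by
  refine ContinuousLinearMap.opNorm_le_bound _ hB fun w => ?_
  rw [toEuclideanCLM_apply_eq_mulE, ← mulE_mulE]
  refine (pow_le_pow_iff_left₀ (norm_nonneg _) (by positivity) two_ne_zero).1 ?_
  have h1 := h (mulE Aᵀ w)
  have h2 := mul_le_mul_of_nonneg_left (norm_sq_mulE_transpose_le A hB h w) hB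
  linarith

lemma gaussianMatrix_operator_bound (n d : ℕ) (hdn : d ≤ n) :
    1 - 2 * Real.exp (-(d : ℝ)) ≤ (gaussianMatrix n d).real
      {Q | 1 / (d : ℝ) * ‖Matrix.toEuclideanCLM (n := Fin n) (𝕜 := ℝ)
        (Matrix.of Q * (Matrix.of Q)ᵀ)‖ ≤ 108 * ((n : ℝ) / d)} := by
  rcases Nat.eq_zero_or_pos d with rfl | hd
  · simp
  have hd' : (0 : ℝ) < d := by exact_mod_cast hd
  have ht := gaussianMatrix_operator_tail n d hd (108 * n)
  have hu := one_le_measureReal_add_of_univ_subset (μ := gaussianMatrix n d)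
    (G := {Q | 1 / (d : ℝ) * ‖Matrix.toEuclideanCLM (n := Fin n) (𝕜 := ℝ)
        (Matrix.of Q * (Matrix.of Q)ᵀ)‖ ≤ 108 * ((n : ℝ) / d)})
    (A := {Q | ∃ u : Vec d, ‖u‖ = 1 ∧ 108 * n ≤ ‖mulE (Matrix.of Q) u‖ ^ 2}) (by
      intro Q _
      simp only [Set.mem_union, Set.mem_ofPred_eq]
      by_contra! hcon
      obtain ⟨h1, h2⟩ := hcon
      refine h1.not_ge ?_
      rw [one_div, inv_mul_le_iff₀ hd']
      have : (d : ℝ) * (108 * (n / d)) = 108 * n := by field_simp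
      rw [this]
      refine norm_toEuclideanCLM_mul_transpose_le _ (by positivity) fun v => ?_
      obtain ⟨u, hu, hmax⟩ := exists_norm_mulE_max hd (Matrix.of Q)
      calc _ ≤ (‖mulE (Matrix.of Q) u‖ * ‖v‖) ^ 2 := pow_le_pow_left₀ (norm_nonneg _) (hmax v) 2
        _ ≤ _ := by rw [mul_pow]; exact mul_le_mul_of_nonneg_right (h2 u hu).le (by positivity))
  -- The constant `108` yields `exp (-3n)`, which absorbs `3 ^ d ≤ 3 ^ n` and `√2 ^ n` and still
  -- leaves `exp (-n)`.
  have hle : Real.exp (-(108 * (n : ℝ) / 36)) * 3 ^ d * √2 ^ n ≤ Real.exp (-(d : ℝ)) := by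
    have e1 : Real.exp (-(108 * (n : ℝ) / 36)) = Real.exp (-3) ^ n := by
      rw [← Real.exp_nat_mul]; congr 1; ring
    have e2 : (3 : ℝ) ^ d ≤ 3 ^ n := pow_le_pow_right₀ (by norm_num) hdn
    have e3 : Real.exp (-3) * 3 * √2 ≤ Real.exp (-1) := by
      have hs2 : √2 ≤ 1.5 := by rw [Real.sqrt_le_left (by norm_num)]; norm_num
      have : Real.exp (-1) = Real.exp (-3) * (Real.exp 1 * Real.exp 1) := by
        rw [← Real.exp_add, ← Real.exp_add]; norm_num
      rw [this, mul_assoc]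
      refine mul_le_mul_of_nonneg_left ?_ (Real.exp_pos _).le
      nlinarith [Real.exp_one_gt_d9]
    calc _ ≤ Real.exp (-3) ^ n * 3 ^ n * √2 ^ n := by rw [e1]; gcongr
      _ = (Real.exp (-3) * 3 * √2) ^ n := by rw [mul_pow, mul_pow]
      _ ≤ Real.exp (-1) ^ n := pow_le_pow_left₀ (by positivity) e3 n
      _ = Real.exp (-(n : ℝ)) := by rw [← Real.exp_nat_mul]; congr 1; ring
      _ ≤ _ := Real.exp_le_exp.2 (by simpa using hdn)
  have := Real.exp_pos (-(d : ℝ))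
  linarith

theorem isGaussianConstants : IsGaussianConstants (1 / 16) 108 where
  pos₀ := by norm_num
  pos := by norm_num
  vector := gaussianMatrix_vector_concentration
  operator := gaussianMatrix_operator_bound

/-! ### Smoothness estimates and finite-difference errors. -/

section Smooth

variable {n : ℕ} {f : Vec n → ℝ} {L : ℝ}

lemma hasDerivAt_line (hf : Differentiable ℝ f) (x h : Vec n) (t : ℝ) :
    HasDerivAt (fun t : ℝ => f (x + t • h)) (inner ℝ (gradient f (x + t • h)) h) t := by
  have h1 : HasDerivAt (fun t : ℝ => x + t • h) h t := by
    simpa using ((hasDerivAt_id t).smul_const h).const_add x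
  have h2 := ((hf (x + t • h)).hasGradientAt.hasFDerivAt).comp_hasDerivAt t h1
  simpa [Function.comp_def] using h2

/-- The quadratic bound on the error of the linear approximation. -/
lemma abs_sub_linear_le (hf : Differentiable ℝ f)
    (hL : ∀ u v, ‖gradient f u - gradient f v‖ ≤ L * ‖u - v‖) (x h : Vec n) :
    |f (x + h) - f x - inner ℝ (gradient f x) h| ≤ L / 2 * ‖h‖ ^ 2 := by
  have hd : ∀ t : ℝ, HasDerivAt
      (fun t : ℝ => f (x + t • h) - f x - t * inner ℝ (gradient f x) h)
      (inner ℝ (gradient f (x + t • h)) h - 1 * inner ℝ (gradient f x) h) t := fun t =>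
    ((hasDerivAt_line hf x h t).sub_const _).sub ((hasDerivAt_id t).mul_const _)
  have hB : ∀ t : ℝ, HasDerivAt (fun t : ℝ => L / 2 * ‖h‖ ^ 2 * t ^ 2) (L * ‖h‖ ^ 2 * t) t := by
    intro t
    exact ((hasDerivAt_pow 2 t).const_mul (L / 2 * ‖h‖ ^ 2)).congr_deriv (by push_cast; ring)
  have := image_norm_le_of_norm_deriv_right_le_deriv_boundary (a := 0) (b := 1)
    (fun t _ => (hd t).continuousAt.continuousWithinAt) (fun t _ => (hd t).hasDerivWithinAt)
    (by simp) hB (fun t ht => ?_) (Set.right_mem_Icc.2 zero_le_one)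
  · simpa using this
  · rw [one_mul, ← inner_sub_left]
    refine (norm_inner_le_norm _ _).trans ?_
    have h1 := hL (x + t • h) x
    rw [add_sub_cancel_left, norm_smul, Real.norm_of_nonneg ht.1] at h1
    nlinarith [norm_nonneg h]

/-- The step `-∇f / L` lowers `f` by at least `‖∇f‖² / (2L)`, and `f` stays above its infimum.
Together with descent this bounds the gradients along a run, hence makes them integrable. -/
lemma gradient_norm_sq_le (hf : Differentiable ℝ f) (hL0 : 0 < L)
    (hL : ∀ u v, ‖gradient f u - gradient f v‖ ≤ L * ‖u - v‖)
    (hb : BddBelow (Set.range f)) (x : Vec n) :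
    ‖gradient f x‖ ^ 2 ≤ 2 * L * (f x - ⨅ x, f x) := by
  have h := (abs_le.1 (abs_sub_linear_le hf hL x (-(L⁻¹ • gradient f x)))).2
  have h2 := ciInf_le hb (x + -(L⁻¹ • gradient f x))
  rw [inner_neg_right, real_inner_smul_right, real_inner_self_eq_norm_sq, norm_neg, norm_smul,
    Real.norm_of_nonneg (by positivity)] at h
  have h3 : L / 2 * (L⁻¹ * ‖gradient f x‖) ^ 2 = L⁻¹ * ‖gradient f x‖ ^ 2 / 2 := by
    field_simp
  rw [h3] at h
  have h4 : L⁻¹ * ‖gradient f x‖ ^ 2 ≤ 2 * (f x - ⨅ x, f x) := by linarith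
  rw [inv_mul_le_iff₀ hL0] at h4
  linarith

variable {l : ℕ}

lemma mulE_single (A : Matrix (Fin n) (Fin l) ℝ) (i : Fin l) (a : Fin n) :
    mulE A (EuclideanSpace.single i 1) a = A a i := by
  simp [mulE_apply]

lemma mulE_transpose_apply (A : Matrix (Fin n) (Fin l) ℝ) (g : Vec n) (i : Fin l) :
    mulE Aᵀ g i = inner ℝ (mulE A (EuclideanSpace.single i 1)) g := by
  rw [← inner_mulE_transpose]
  simp [EuclideanSpace.inner_single_left]

/-- Both linear approximations err by at most `L ε² ‖a‖² / 2`. With the gradient merely Lipschitz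
these errors need not cancel, so the central difference is accurate only to first order in `ε`. -/
lemma abs_fdGrad_sub_le (hf : Differentiable ℝ f)
    (hL : ∀ u v, ‖gradient f u - gradient f v‖ ≤ L * ‖u - v‖) (A : Matrix (Fin n) (Fin l) ℝ)
    {ε : ℝ} (hε : 0 < ε) (x : Vec n) (i : Fin l) :
    |fdGrad f A ε x i - mulE Aᵀ (gradient f x) i| ≤
      L * ε / 2 * ‖mulE A (EuclideanSpace.single i 1)‖ ^ 2 := by
  set a := mulE A (EuclideanSpace.single i 1) with ha
  have h1 := abs_le.1 (abs_sub_linear_le hf hL x (ε • a))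
  have h2 := abs_le.1 (abs_sub_linear_le hf hL x (-(ε • a)))
  rw [← sub_eq_add_neg, inner_neg_right, norm_neg] at h2
  rw [real_inner_smul_right, norm_smul, Real.norm_of_nonneg hε.le, mul_pow] at h1 h2
  rw [mulE_transpose_apply, ← ha, real_inner_comm]
  have h3 : fdGrad f A ε x i - inner ℝ (gradient f x) a =
      (f (x + ε • a) - f (x - ε • a) - 2 * ε * inner ℝ (gradient f x) a) / (2 * ε) := by
    simp only [fdGrad, ← ha]
    field_simp
  rw [h3, abs_div, abs_of_pos (by positivity : 0 < 2 * ε), div_le_iff₀ (by positivity), abs_le]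
  constructor <;> nlinarith [h1.1, h1.2, h2.1, h2.2]

lemma norm_fdGrad_sub_le (hf : Differentiable ℝ f) (hL0 : 0 < L)
    (hL : ∀ u v, ‖gradient f u - gradient f v‖ ≤ L * ‖u - v‖) (A : Matrix (Fin n) (Fin l) ℝ)
    {ε : ℝ} (hε : 0 < ε) (x : Vec n) {b : ℝ}
    (hA : ∀ i, ‖mulE A (EuclideanSpace.single i 1)‖ ^ 2 ≤ b) (hb : 0 ≤ b) :
    ‖fdGrad f A ε x - mulE Aᵀ (gradient f x)‖ ≤ L * ε / 2 * b * √(l : ℝ) := by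
  refine (pow_le_pow_iff_left₀ (norm_nonneg _) (by positivity) two_ne_zero).1 ?_
  rw [EuclideanSpace.norm_sq_eq, mul_pow, Real.sq_sqrt (by positivity)]
  have : ∀ i ∈ Finset.univ, ‖(fdGrad f A ε x - mulE Aᵀ (gradient f x)) i‖ ^ 2 ≤
      (L * ε / 2 * b) ^ 2 := by
    intro i _
    refine pow_le_pow_left₀ (norm_nonneg _) ?_ 2
    rw [Real.norm_eq_abs, PiLp.sub_apply]
    exact (abs_fdGrad_sub_le hf hL A hε x i).trans
      (mul_le_mul_of_nonneg_left (hA i) (by positivity))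
  refine (Finset.sum_le_card_nsmul _ _ _ this).trans (le_of_eq ?_)
  simp [mul_comm]

/-- Triangle inequality over the columns, then Cauchy–Schwarz; the source of the factor `m` in
`alphaBar`. -/
lemma norm_sq_mulE_le_of_columns (P : Matrix (Fin n) (Fin l) ℝ)
    (hP : ∀ j, ‖mulE P (EuclideanSpace.single j 1)‖ ≤ 1) (v : Vec l) :
    ‖mulE P v‖ ^ 2 ≤ l * ‖v‖ ^ 2 := by
  have h1 : mulE P v = ∑ j, v j • mulE P (EuclideanSpace.single j 1) := by
    ext i
    simp [mulE_apply, mul_comm]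
  have h2 : ‖mulE P v‖ ≤ ∑ j, ‖v j‖ := by
    rw [h1]
    refine (norm_sum_le _ _).trans (Finset.sum_le_sum fun j _ => ?_)
    rw [norm_smul]
    exact mul_le_of_le_one_right (norm_nonneg _) (hP j)
  refine (pow_le_pow_left₀ (norm_nonneg _) h2 2).trans ?_
  rw [EuclideanSpace.norm_sq_eq]
  simpa using sq_sum_le_card_mul_sum_sq (s := Finset.univ) (f := fun j => ‖v j‖)

end Smooth

/-! ### Consequences of the spectral bounds on `H`. -/

section SpectralBounds

variable {m : ℕ} {H : Matrix (Fin m) (Fin m) ℝ} {M₁ M₂ : ℝ}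

lemma inner_mulE_nonneg (hH : H.PosSemidef) (q : Vec m) : 0 ≤ inner ℝ q (mulE H q) := by
  have := hH.dotProduct_mulVec_nonneg q.ofLp
  simpa [PiLp.inner_apply, mulE, dotProduct, mul_comm] using this

lemma mulE_sub_smul_one (r : ℝ) (q : Vec m) :
    mulE (H - r • (1 : Matrix (Fin m) (Fin m) ℝ)) q = mulE H q - r • q := by
  simp [mulE]

lemma mulE_smul_one_sub (r : ℝ) (q : Vec m) :
    mulE (r • (1 : Matrix (Fin m) (Fin m) ℝ) - H) q = r • q - mulE H q := by
  simp [mulE]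

lemma transpose_eq_of_sub_smul_one_posSemidef
    (h : (H - M₁ • (1 : Matrix (Fin m) (Fin m) ℝ)).PosSemidef) : Hᵀ = H := by
  have h1 := h.isHermitian
  rw [Matrix.IsHermitian, Matrix.conjTranspose_eq_transpose_of_trivial, Matrix.transpose_sub,
    Matrix.transpose_smul, Matrix.transpose_one] at h1
  exact sub_left_injective h1

lemma mul_norm_sq_le_inner (h : (H - M₁ • (1 : Matrix (Fin m) (Fin m) ℝ)).PosSemidef) (q : Vec m) :
    M₁ * ‖q‖ ^ 2 ≤ inner ℝ q (mulE H q) := by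
  have := inner_mulE_nonneg h q
  rw [mulE_sub_smul_one, inner_sub_right, real_inner_smul_right, real_inner_self_eq_norm_sq] at this
  linarith

lemma inner_le_mul_norm_sq (h : (M₂ • (1 : Matrix (Fin m) (Fin m) ℝ) - H).PosSemidef) (q : Vec m) :
    inner ℝ q (mulE H q) ≤ M₂ * ‖q‖ ^ 2 := by
  have := inner_mulE_nonneg h q
  rw [mulE_smul_one_sub, inner_sub_right, real_inner_smul_right, real_inner_self_eq_norm_sq] at this
  linarith

/-- Avoids a square root of `H`: with `y = H q`, expand `⟨z, H z⟩ ≥ 0` at `z = M₂ q - y` and use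
`⟨y, H y⟩ ≤ M₂ ‖y‖²`. -/
lemma norm_sq_mulE_le_inner (hM₁ : 0 < M₁) (hM₂ : 0 < M₂)
    (h₁ : (H - M₁ • (1 : Matrix (Fin m) (Fin m) ℝ)).PosSemidef)
    (h₂ : (M₂ • (1 : Matrix (Fin m) (Fin m) ℝ) - H).PosSemidef) (q : Vec m) :
    ‖mulE H q‖ ^ 2 ≤ M₂ * inner ℝ q (mulE H q) := by
  have hT := transpose_eq_of_sub_smul_one_posSemidef h₁
  set y := mulE H q with hy
  have e1 := inner_le_mul_norm_sq h₂ y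
  have e2 : 0 ≤ inner ℝ (M₂ • q - y) (mulE H (M₂ • q - y)) :=
    (by positivity : 0 ≤ M₁ * ‖M₂ • q - y‖ ^ 2).trans (mul_norm_sq_le_inner h₁ _)
  have e3 : inner ℝ q (mulE H y) = ‖y‖ ^ 2 := by
    rw [← real_inner_self_eq_norm_sq]
    conv_lhs => rw [← hT]
    rw [inner_mulE_transpose]
  rw [mulE_sub, mulE_smul, ← hy, inner_sub_left, inner_sub_right, inner_sub_right,
    real_inner_smul_left, real_inner_smul_left, real_inner_smul_right, real_inner_smul_right,
    e3, real_inner_self_eq_norm_sq] at e2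
  refine le_of_mul_le_mul_left (a := M₂) ?_ hM₂
  linarith

/-- The ordering of `M₁` and `M₂` is not assumed; a nonempty matrix between the two bounds forces
it. -/
lemma spectral_bounds_le (hm : 0 < m)
    (h₁ : (H - M₁ • (1 : Matrix (Fin m) (Fin m) ℝ)).PosSemidef)
    (h₂ : (M₂ • (1 : Matrix (Fin m) (Fin m) ℝ) - H).PosSemidef) : M₁ ≤ M₂ := by
  have e1 := mul_norm_sq_le_inner h₁ (EuclideanSpace.single ⟨0, hm⟩ 1)
  have e2 := inner_le_mul_norm_sq h₂ (EuclideanSpace.single ⟨0, hm⟩ 1)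
  simp only [PiLp.norm_single, norm_one, one_pow, mul_one] at e1 e2
  linarith

end SpectralBounds

/-! ### Backtracking line search. -/

section LineSearch

variable {n m : ℕ} {f : Vec n → ℝ} {β c : ℝ} {x : Vec n} {P : Matrix (Fin n) (Fin m) ℝ}
  {v q : Vec m}

lemma stepSize_nonneg (hβ : 0 ≤ β) : 0 ≤ stepSize f β c x P v q := by
  unfold stepSize
  split_ifs
  · positivity
  · rfl

/-- The fallback step `0` satisfies the condition with equality. -/
lemma armijo_stepSize : Armijo f c x P v q (stepSize f β c x P v q) := by
  unfold stepSize
  split_ifs with h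
  · classical
    convert Nat.find_spec h
  · simp [Armijo]

/-- Unless the first trial is accepted, the trial before the accepted one was rejected and hence
exceeded `A`. -/
lemma min_le_stepSize (hβ : 0 < β) (hβ1 : β < 1) {A : ℝ} (hA : 0 < A)
    (h : ∀ α, 0 < α → α ≤ A → Armijo f c x P v q α) :
    min 1 (β * A) ≤ stepSize f β c x P v q := by
  obtain ⟨i, hi⟩ := exists_pow_lt_of_lt_one hA hβ1
  have hex : ∃ i : ℕ, Armijo f c x P v q (β ^ i) := ⟨i, h _ (by positivity) hi.le⟩
  classical
  have hs : stepSize f β c x P v q = β ^ Nat.find hex := by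
    rw [stepSize, dif_pos hex]
  rw [hs]
  rcases hk : Nat.find hex with _ | k
  · simp
  · have hnot := Nat.find_min hex (m := k) (by omega)
    have hlt : A < β ^ k := by
      by_contra! hle
      exact hnot (h _ (by positivity) hle)
    refine (min_le_right _ _).trans ?_
    rw [pow_succ']
    exact mul_le_mul_of_nonneg_left hlt.le hβ.le

end LineSearch

/-! ### The decrease in one iteration. -/

section Step

variable {n m d : ℕ} {f : Vec n → ℝ} {L : ℝ} {β c M₁ M₂ : ℝ}

/-- Let `W = ⟨q, H q⟩`. The error of `q` changes the slope along the search direction by at most `c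
W`, so the slope is at most `-(1 - c) W`. For steps up to `2(1 - 2c) / (m M₂ L)` the curvature term
gives back at most `(1 - 2c) W` per unit of step, which leaves the Armijo decrease `c W`. -/
lemma fdGrad_lineSearch_le (hf : Differentiable ℝ f) (hL0 : 0 < L)
    (hL : ∀ u v, ‖gradient f u - gradient f v‖ ≤ L * ‖u - v‖)
    (hβ : 0 < β) (hβ1 : β < 1) (hc : 0 < c) (hc2 : c < 1 / 2) (hM₁ : 0 < M₁) (hM₂ : 0 < M₂)
    (hm : 0 < m) {x : Vec n} {P : Matrix (Fin n) (Fin m) ℝ} {H : Matrix (Fin m) (Fin m) ℝ}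
    (hP : ∀ j, ‖mulE P (EuclideanSpace.single j 1)‖ ≤ 1)
    (h₁ : (H - M₁ • (1 : Matrix (Fin m) (Fin m) ℝ)).PosSemidef)
    (h₂ : (M₂ • (1 : Matrix (Fin m) (Fin m) ℝ) - H).PosSemidef) {q : Vec m}
    (hη : ‖q - mulE Pᵀ (gradient f x)‖ * M₂ ≤ c * M₁ * ‖q‖) :
    f (x + stepSize f β c x P (-mulE H q) q • mulE P (-mulE H q)) ≤
      f x - c * alphaBar β c M₂ L m * M₁ * ‖q‖ ^ 2 := by
  set W := inner ℝ q (mulE H q) with hW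
  have hW1 : M₁ * ‖q‖ ^ 2 ≤ W := mul_norm_sq_le_inner h₁ q
  have hW0 : 0 ≤ W := (by positivity : 0 ≤ M₁ * ‖q‖ ^ 2).trans hW1
  have hW2 : W ≤ M₂ * ‖q‖ ^ 2 := inner_le_mul_norm_sq h₂ q
  have hv2 : ‖mulE H q‖ ^ 2 ≤ M₂ * W := norm_sq_mulE_le_inner hM₁ hM₂ h₁ h₂ q
  have hv : ‖mulE H q‖ ≤ M₂ * ‖q‖ := by
    refine (pow_le_pow_iff_left₀ (norm_nonneg _) (by positivity) two_ne_zero).1 ?_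
    nlinarith
  have hm' : (0 : ℝ) < m := by exact_mod_cast hm
  set v := -mulE H q with hvdef
  have hqv : inner ℝ q v = -W := by rw [hvdef, inner_neg_right]
  have hnv : ‖v‖ = ‖mulE H q‖ := norm_neg _
  have hA : (0 : ℝ) < 2 * (1 - 2 * c) / (m * M₂ * L) := by
    have : 0 < 1 - 2 * c := by linarith
    positivity
  have harm : ∀ α, 0 < α → α ≤ 2 * (1 - 2 * c) / (m * M₂ * L) → Armijo f c x P v q α := by
    intro α hα hαA
    have h1 := (abs_le.1 (abs_sub_linear_le hf hL x (α • mulE P v))).2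
    have h2 := norm_sq_mulE_le_of_columns P hP v
    rw [real_inner_smul_right, norm_smul, Real.norm_of_nonneg hα.le, mul_pow, real_inner_comm,
      ← inner_mulE_transpose] at h1
    have h3 : inner ℝ v (mulE Pᵀ (gradient f x)) =
        -W - inner ℝ v (q - mulE Pᵀ (gradient f x)) := by
      rw [inner_sub_right, ← hqv, real_inner_comm v q]; ring
    have h4 : -inner ℝ v (q - mulE Pᵀ (gradient f x)) ≤ c * W := by
      refine (neg_le_abs _).trans ((abs_real_inner_le_norm _ _).trans ?_)
      rw [hnv]
      calc _ ≤ M₂ * ‖q‖ * ‖q - mulE Pᵀ (gradient f x)‖ :=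
            mul_le_mul_of_nonneg_right hv (norm_nonneg _)
        _ ≤ c * (M₁ * ‖q‖ ^ 2) := by nlinarith [norm_nonneg q]
        _ ≤ c * W := mul_le_mul_of_nonneg_left hW1 hc.le
    have h5 : L / 2 * (α ^ 2 * ‖mulE P v‖ ^ 2) ≤ α * ((1 - 2 * c) * W) := by
      have h6 : α * (m * M₂ * L) ≤ 2 * (1 - 2 * c) := (le_div_iff₀ (by positivity)).1 hαA
      calc _ ≤ L / 2 * (α ^ 2 * (m * (M₂ * W))) := by rw [hnv] at h2; gcongr; nlinarith
        _ = α * (α * (m * M₂ * L) / 2 * W) := by ring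
        _ ≤ _ := by gcongr; linarith
    rw [h3] at h1
    rw [Armijo, hqv]
    nlinarith
  have hs := min_le_stepSize hβ hβ1 hA harm
  have hα : alphaBar β c M₂ L m ≤ stepSize f β c x P v q := by
    refine le_trans (le_of_eq ?_) hs
    rw [alphaBar]
    congr 1
    ring
  have hα0 : 0 ≤ alphaBar β c M₂ L m := le_min zero_le_one (by
    have : 0 < 1 - 2 * c := by linarith
    positivity)
  have har := armijo_stepSize (f := f) (β := β) (c := c) (x := x) (P := P) (v := v) (q := q)
  rw [Armijo, hqv] at har
  have h7 : alphaBar β c M₂ L m * (M₁ * ‖q‖ ^ 2) ≤ stepSize f β c x P v q * W :=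
    mul_le_mul hα hW1 (by positivity) (hα0.trans hα)
  nlinarith

/-- The properties of the state that every iteration preserves. -/
structure State.Regular (M₁ M₂ : ℝ) (S : State n m) : Prop where
  columns : ∀ j, ‖mulE S.P (EuclideanSpace.single j 1)‖ ≤ 1
  lower : (S.H - M₁ • (1 : Matrix (Fin m) (Fin m) ℝ)).PosSemidef
  upper : (M₂ • (1 : Matrix (Fin m) (Fin m) ℝ) - S.H).PosSemidef

/-- Not an equality, because a zero vector stays zero; this is why `State.Regular` bounds the
columns by `1` only. -/
lemma norm_inv_norm_smul_le_one (u : Vec n) : ‖(‖u‖)⁻¹ • u‖ ≤ 1 := by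
  rw [norm_smul, norm_inv, norm_norm]
  exact inv_mul_le_one

lemma mulE_updateP_single (P : Matrix (Fin n) (Fin m) ℝ) (u v : Vec n) (j : Fin m) :
    mulE (updateP P u v) (EuclideanSpace.single j 1) =
      if h : (j : ℕ) + 2 < m then mulE P (EuclideanSpace.single ⟨(j : ℕ) + 2, h⟩ 1)
      else if (j : ℕ) + 2 = m then (‖u‖)⁻¹ • u else (‖v‖)⁻¹ • v := by
  ext a
  rw [mulE_single]
  split_ifs with h1 h2
  · rw [mulE_single]; simp [updateP, h1]
  · simp [updateP, h2]
  · simp [updateP, h1, h2]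

lemma norm_mulE_updateP_single_le {P : Matrix (Fin n) (Fin m) ℝ}
    (hP : ∀ j, ‖mulE P (EuclideanSpace.single j 1)‖ ≤ 1) (u v : Vec n) (j : Fin m) :
    ‖mulE (updateP P u v) (EuclideanSpace.single j 1)‖ ≤ 1 := by
  rw [mulE_updateP_single]
  split_ifs
  · exact hP _
  · exact norm_inv_norm_smul_le_one u
  · exact norm_inv_norm_smul_le_one v

/-- The objective never increases. -/
lemma step_descent (hβ : 0 ≤ β) (hc : 0 ≤ c) (hM₁ : 0 ≤ M₁) {S : State n m}
    (hS : S.Regular M₁ M₂) (ε : ℝ) (Q : Matrix (Fin n) (Fin d) ℝ) :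
    f (step f β c M₁ M₂ ε Q S).x ≤ f S.x := by
  set P := updateP S.P S.x (mulE Q (fdGrad f Q ε S.x))
  set q := fdGrad f P ε S.x
  have har := armijo_stepSize (f := f) (β := β) (c := c) (x := S.x) (P := P)
    (v := -mulE S.H q) (q := q)
  rw [Armijo, inner_neg_right] at har
  have h1 := mul_norm_sq_le_inner hS.lower q
  have h2 : 0 ≤ c * stepSize f β c S.x P (-mulE S.H q) q * inner ℝ q (mulE S.H q) :=
    mul_nonneg (mul_nonneg hc (stepSize_nonneg hβ))
      ((by positivity : 0 ≤ M₁ * ‖q‖ ^ 2).trans h1)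
  change f (S.x + stepSize f β c S.x P (-mulE S.H q) q • mulE P (-mulE S.H q)) ≤ _
  linarith

set_option maxHeartbeats 1000000 in
/-- If the random subspace captures the gradient, its approximation in the subspace is not too
small and accurate enough. -/
lemma subspace_gradient_bounds (hf : Differentiable ℝ f) (hL0 : 0 < L)
    (hL : ∀ u v, ‖gradient f u - gradient f v‖ ≤ L * ‖u - v‖)
    {C ϵ a X ε : ℝ} (hC : 1 ≤ C) (hd : 0 < d) (hdn : d ≤ n) (hm : 2 ≤ m)
    (hϵ0 : 0 < ϵ) (hϵ1 : ϵ < 1) (ha : 1 - ϵ ≤ a) (ha' : 1 / 256 ≤ a) (hX : 3 ≤ X) (hε : 0 < ε)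
    {P : Matrix (Fin n) (Fin m) ℝ} (hP : ∀ j, ‖mulE P (EuclideanSpace.single j 1)‖ ≤ 1)
    (x : Vec n) (Q : Matrix (Fin n) (Fin d) ℝ)
    (hQ₁ : a * d * ‖gradient f x‖ ^ 2 ≤ ‖mulE Qᵀ (gradient f x)‖ ^ 2)
    (hQ₂ : ∀ w, ‖mulE Qᵀ w‖ ^ 2 ≤ C * n * ‖w‖ ^ 2)
    (hg₁ : 4 * √(d : ℝ) * C * n / (1 - ϵ) * L * ε < ‖gradient f x‖)
    (hg₂ : 6 * C * n * (m : ℝ) ^ 2 / d * X * L * ε < ‖gradient f x‖)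
    {p : Matrix (Fin n) (Fin m) ℝ} (hp : p = updateP P x (mulE Q (fdGrad f Q ε x))) :
    ‖fdGrad f p ε x - mulE pᵀ (gradient f x)‖ * (X - 1) ≤ ‖fdGrad f p ε x‖ ∧
      ((1 - ϵ) * d / (3 * C * n)) ^ 2 * ‖gradient f x‖ ^ 2 ≤ 2 * ‖fdGrad f p ε x‖ ^ 2 := by
  have hpcol : ∀ j, ‖mulE p (EuclideanSpace.single j 1)‖ ≤ 1 := by
    rw [hp]; exact norm_mulE_updateP_single_le hP _ _
  set g := gradient f x with hg
  have hd' : (1 : ℝ) ≤ d := by exact_mod_cast hd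
  have hdn' : (d : ℝ) ≤ n := by exact_mod_cast hdn
  have hm' : (2 : ℝ) ≤ m := by exact_mod_cast hm
  have hn' : (1 : ℝ) ≤ n := hd'.trans hdn'
  set N := C * n with hN
  have hN1 : 1 ≤ N := one_le_mul_of_one_le_of_one_le hC hn'
  have hdN : (d : ℝ) ≤ N := hdn'.trans (le_mul_of_one_le_left (by positivity) hC)
  have h1ϵ2 : (1 - ϵ) ^ 2 ≤ a :=
    (pow_le_of_le_one (by linarith) (by linarith) two_ne_zero).trans ha
  set ρ := d / N with hρ
  have hρ0 : 0 < ρ := by positivity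
  have hρ1 : ρ ≤ 1 := (div_le_one (by positivity)).2 hdN
  have h1ϵ : 0 < 1 - ϵ := by linarith
  have hG : 0 < ‖g‖ := lt_of_le_of_lt (by positivity) hg₁
  set h := mulE Qᵀ g with hh
  set h' := fdGrad f Q ε x with hh'
  have hQcol : ∀ v, ‖mulE Q v‖ ^ 2 ≤ N * ‖v‖ ^ 2 := fun v =>
    norm_sq_mulE_transpose_le Qᵀ (by positivity) hQ₂ v
  -- accuracy of the finite differences along the columns of `Q`
  have hδ : ‖h' - h‖ ≤ L * ε / 2 * N * √(d : ℝ) :=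
    norm_fdGrad_sub_le hf hL0 hL Q hε x (fun i => by simpa using hQcol (EuclideanSpace.single i 1))
      (by positivity)
  have hg₁' : 4 * √(d : ℝ) * N * L * ε < (1 - ϵ) * ‖g‖ := by
    have e : 4 * √(d : ℝ) * C * n / (1 - ϵ) * L * ε = 4 * √(d : ℝ) * N * L * ε / (1 - ϵ) := by
      rw [hN]; ring
    rw [e, div_lt_iff₀ h1ϵ] at hg₁
    linarith
  -- Uses `(1 - ϵ)² ≤ 1 - ϵ ≤ a ≤ a d`.
  have hhG : (1 - ϵ) * ‖g‖ ≤ ‖h‖ := by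
    refine (pow_le_pow_iff_left₀ (by positivity) (norm_nonneg _) two_ne_zero).1 ?_
    refine le_trans ?_ hQ₁
    rw [mul_pow]
    exact mul_le_mul_of_nonneg_right
      (h1ϵ2.trans (le_mul_of_one_le_right (by linarith) hd')) (by positivity)
  have hh0 : 0 < ‖h‖ := (mul_pos h1ϵ hG).trans_le hhG
  -- The first term of `biasConst`, times `ε`, is eight times the bound `hδ`, divided by `1 - ϵ`.
  have hδ8 : ‖h' - h‖ ≤ ‖h‖ / 8 := by
    have : L * ε / 2 * N * √(d : ℝ) = 4 * √(d : ℝ) * N * L * ε / 8 := by ring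
    linarith
  have hinner : 7 / 8 * ‖h‖ ^ 2 ≤ inner ℝ h' h := by
    have e : inner ℝ h' h = ‖h‖ ^ 2 + inner ℝ (h' - h) h := by
      rw [inner_sub_left, real_inner_self_eq_norm_sq]; ring
    have := (abs_le.1 (abs_real_inner_le_norm (h' - h) h)).1
    have := mul_le_mul_of_nonneg_right hδ8 hh0.le
    linarith
  have hh'le : ‖h'‖ ≤ 9 / 8 * ‖h‖ := by
    have := norm_sub_norm_le h' h
    linarith
  set w := mulE Q h' with hw
  have hwg : inner ℝ w g = inner ℝ h' h := by rw [hw, ← inner_mulE_transpose]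
  have hw0 : 0 < ‖w‖ := by
    rw [norm_pos_iff]
    rintro h0
    rw [h0, inner_zero_left] at hwg
    linarith [pow_pos hh0 2]
  -- the gradient in the subspace
  set T := ‖mulE pᵀ g‖ with hT
  -- One entry of `pᵀ g` is `⟨w, g⟩ / ‖w‖`: the index `m - 1` falls into the last branch of
  -- `updateP`.
  have hTw : inner ℝ w g ≤ T * ‖w‖ := by
    have hcol : mulE p (EuclideanSpace.single ⟨m - 1, by omega⟩ 1) = (‖w‖)⁻¹ • w := by
      rw [hp, mulE_updateP_single, dif_neg (by simp; omega), if_neg (by simp; omega)]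
    have e := mulE_transpose_apply p g ⟨m - 1, by omega⟩
    rw [hcol, real_inner_smul_left] at e
    have e2 := (le_abs_self _).trans (PiLp.norm_apply_le (mulE pᵀ g) ⟨m - 1, by omega⟩)
    rw [e, inv_mul_le_iff₀ hw0] at e2
    linarith
  -- From `7/8 ‖h‖² ≤ T ‖w‖` and `‖w‖ ≤ √N * 9/8 ‖h‖`; the quotient `7/9` is squared.
  have hT2 : 49 / 81 * (a * ρ * ‖g‖ ^ 2) ≤ T ^ 2 := by
    have e1 : (7 / 8 * ‖h‖ ^ 2) ^ 2 ≤ (T * ‖w‖) ^ 2 :=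
      pow_le_pow_left₀ (by positivity) ((hinner.trans hwg.ge).trans hTw) 2
    have e2 : ‖w‖ ^ 2 ≤ N * (9 / 8 * ‖h‖) ^ 2 :=
      (hQcol h').trans (by gcongr)
    have e3 : (7 / 8 * ‖h‖ ^ 2) ^ 2 ≤ T ^ 2 * (N * (9 / 8 * ‖h‖) ^ 2) := by
      rw [mul_pow T] at e1
      exact e1.trans (mul_le_mul_of_nonneg_left e2 (sq_nonneg T))
    have e4 : 49 / 81 * ‖h‖ ^ 2 ≤ T ^ 2 * N := by
      refine le_of_mul_le_mul_right (a := ‖h‖ ^ 2) ?_ (by positivity)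
      linarith
    have e5 : 49 / 81 * (a * ρ * ‖g‖ ^ 2) = 49 / 81 * (a * d * ‖g‖ ^ 2) / N := by
      rw [hρ]; ring
    rw [e5, div_le_iff₀ (by positivity)]
    linarith
  -- accuracy of the finite differences in the subspace
  set q := fdGrad f p ε x with hq
  set η := ‖q - mulE pᵀ g‖ with hη
  have hη1 : η ≤ L * ε / 2 * 1 * √(m : ℝ) :=
    norm_fdGrad_sub_le hf hL0 hL p hε x
      (fun i => pow_le_one₀ (norm_nonneg _) (hpcol i))
      zero_le_one
  -- The second term of `biasConst` is made for this, after `√m ≤ m² / 2`, which needs `m ≥ 2`.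
  have hηX : η * X ≤ ρ * ‖g‖ / 24 := by
    have hsm : √(m : ℝ) ≤ (m : ℝ) ^ 2 / 2 := by
      have := mul_le_mul_of_nonneg_right hm' (by linarith : (0 : ℝ) ≤ m)
      have : √(m : ℝ) ≤ m := Real.sqrt_le_iff.2 ⟨by linarith, by nlinarith⟩
      linarith
    have e1 : 6 * N * (m : ℝ) ^ 2 * X * L * ε < d * ‖g‖ := by
      have e : 6 * C * n * (m : ℝ) ^ 2 / d * X * L * ε = 6 * N * (m : ℝ) ^ 2 * X * L * ε / d := by
        rw [hN]; ring
      rw [e, div_lt_iff₀ (by positivity)] at hg₂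
      linarith
    have e2 : ρ * ‖g‖ / 24 = d * ‖g‖ / 24 / N := by rw [hρ]; ring
    rw [e2, le_div_iff₀ (by positivity)]
    calc η * X * N ≤ L * ε / 2 * 1 * ((m : ℝ) ^ 2 / 2) * X * N := by
          gcongr; exact hη1.trans (by gcongr)
      _ = 6 * N * (m : ℝ) ^ 2 * X * L * ε / 24 := by ring
      _ ≤ _ := by linarith
  -- Compares `ρ² / 576` with `49/81 * ρ / 256`. The bound `hηX` carries no factor `1 - ϵ`, so a
  -- lower bound on `a` independent of `ϵ` is indispensable here.
  have hηT : η * X ≤ T := by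
    refine (pow_le_pow_iff_left₀ (by positivity) (norm_nonneg _) two_ne_zero).1 ?_
    refine (pow_le_pow_left₀ (by positivity) hηX 2).trans (le_trans ?_ hT2)
    have e1 : 1 / 256 * ρ ≤ a * ρ := mul_le_mul_of_nonneg_right ha' hρ0.le
    have e2 : ρ ^ 2 ≤ ρ := pow_le_of_le_one hρ0.le hρ1 two_ne_zero
    have e3 : (ρ * ‖g‖ / 24) ^ 2 = ρ ^ 2 / 576 * ‖g‖ ^ 2 := by ring
    have e4 : 49 / 81 * (a * ρ * ‖g‖ ^ 2) = 49 / 81 * (a * ρ) * ‖g‖ ^ 2 := by ring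
    rw [e3, e4]
    exact mul_le_mul_of_nonneg_right (by linarith) (by positivity)
  have hqT : T - η ≤ ‖q‖ := by
    have := norm_sub_norm_le (mulE pᵀ g) q
    rw [norm_sub_rev] at this
    linarith
  have hη0 : 0 ≤ η := norm_nonneg _
  refine ⟨by linarith, ?_⟩
  -- Since `3 η ≤ η X ≤ T`.
  have hq23 : 2 / 3 * T ≤ ‖q‖ := by
    have := mul_le_mul_of_nonneg_left hX hη0
    linarith
  have hq2 := pow_le_pow_left₀ (by positivity) hq23 2
  have e1 : ((1 - ϵ) * d / (3 * C * n)) ^ 2 = ((1 - ϵ) ^ 2 * ρ ^ 2) / 9 := by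
    rw [hρ, hN]; field_simp; ring
  have e2 : (1 - ϵ) ^ 2 * ρ ^ 2 ≤ a * ρ := by
    exact mul_le_mul h1ϵ2 (pow_le_of_le_one hρ0.le hρ1 two_ne_zero) (by positivity) (by linarith)
  rw [e1]
  have e3 := mul_le_mul_of_nonneg_right e2 (sq_nonneg ‖g‖)
  have e4 : 0 ≤ a * ρ * ‖g‖ ^ 2 := mul_nonneg (mul_nonneg (by linarith) hρ0.le) (sq_nonneg _)
  linarith

/-- The guaranteed decrease in one iteration, when the random subspace captures the gradient. -/
lemma step_decrease (hf : Differentiable ℝ f) (hL0 : 0 < L)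
    (hL : ∀ u v, ‖gradient f u - gradient f v‖ ≤ L * ‖u - v‖)
    (hβ : 0 < β) (hβ1 : β < 1) (hc : 0 < c) (hc2 : c < 1 / 2) (hM₁ : 0 < M₁) (hM₂ : 0 < M₂)
    {C ϵ a ε : ℝ} (hC : 1 ≤ C) (hd : 0 < d) (hdn : d ≤ n) (hm : 2 ≤ m)
    (hϵ0 : 0 < ϵ) (hϵ1 : ϵ < 1) (ha : 1 - ϵ ≤ a) (ha' : 1 / 256 ≤ a) (hε : 0 < ε)
    {S : State n m} (hS : S.Regular M₁ M₂) (Q : Matrix (Fin n) (Fin d) ℝ)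
    (hQ₁ : a * d * ‖gradient f S.x‖ ^ 2 ≤ ‖mulE Qᵀ (gradient f S.x)‖ ^ 2)
    (hQ₂ : ∀ w, ‖mulE Qᵀ w‖ ^ 2 ≤ C * n * ‖w‖ ^ 2) :
    f (step f β c M₁ M₂ ε Q S).x ≤ f S.x - c * alphaBar β c M₂ L m * M₁ / 2 *
      ((1 - ϵ) * d / (3 * C * n)) ^ 2 *
        (‖gradient f S.x‖ ^ 2 - biasConst C ϵ c M₁ M₂ L n m d ^ 2 * ε ^ 2) := by
  have hα0 : 0 ≤ alphaBar β c M₂ L m := le_min zero_le_one (by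
    have : 0 < 1 - 2 * c := by linarith
    positivity)
  set b := ((1 - ϵ) * d / (3 * C * n)) ^ 2 with hb
  have hb0 : 0 ≤ b := sq_nonneg _
  set K := biasConst C ϵ c M₁ M₂ L n m d with hK
  have h1ϵ : 0 < 1 - ϵ := by linarith
  have hK0 : 0 ≤ K := mul_nonneg (le_max_of_le_left (by positivity)) hL0.le
  -- Below the threshold `K ε` the claimed decrease is nonpositive, and descent suffices.
  rcases le_or_gt (‖gradient f S.x‖) (K * ε) with hle | hgt
  · have h1 := step_descent (f := f) (d := d) hβ.le hc.le hM₁.le hS ε Q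
    have h2 := pow_le_pow_left₀ (norm_nonneg _) hle 2
    rw [mul_pow] at h2
    have h3 : 0 ≤ c * alphaBar β c M₂ L m * M₁ / 2 * b *
        (K ^ 2 * ε ^ 2 - ‖gradient f S.x‖ ^ 2) := mul_nonneg (by positivity) (by linarith)
    linarith
  have hM := spectral_bounds_le (by omega) hS.lower hS.upper
  -- `X - 1` is the accuracy ratio that the line search requires; `M₁ ≤ M₂` and `c < 1/2` make it at
  -- least `2`.
  set X := M₂ / (M₁ * c) + 1 with hX
  have hX3 : 3 ≤ X := by
    have : 2 ≤ M₂ / (M₁ * c) := by rw [le_div_iff₀ (by positivity)]; nlinarith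
    linarith
  have hk₁ : 4 * √(d : ℝ) * C * n / (1 - ϵ) * L * ε ≤ K * ε := by
    rw [hK, biasConst]; gcongr; exact le_max_left _ _
  have hk₂ : 6 * C * n * (m : ℝ) ^ 2 / d * X * L * ε ≤ K * ε := by
    rw [hK, biasConst]; gcongr; exact le_max_right _ _
  obtain ⟨h1, h2⟩ := subspace_gradient_bounds hf hL0 hL hC hd hdn hm hϵ0 hϵ1 ha ha' hX3 hε
    hS.columns S.x Q hQ₁ hQ₂ (hk₁.trans_lt hgt) (hk₂.trans_lt hgt) rfl
  set P := updateP S.P S.x (mulE Q (fdGrad f Q ε S.x))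
  set q := fdGrad f P ε S.x
  have h3 : ‖q - mulE Pᵀ (gradient f S.x)‖ * M₂ ≤ c * M₁ * ‖q‖ := by
    have e : M₂ = (X - 1) * (M₁ * c) := by rw [hX]; field_simp; ring
    rw [e, ← mul_assoc]
    calc _ ≤ ‖q‖ * (M₁ * c) := mul_le_mul_of_nonneg_right h1 (by positivity)
      _ = _ := by ring
  have h4 := fdGrad_lineSearch_le hf hL0 hL hβ hβ1 hc hc2 hM₁ hM₂ (by omega)
    (norm_mulE_updateP_single_le hS.columns _ _) hS.lower hS.upper h3
  refine le_trans h4 ?_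
  have h5 : 0 ≤ c * alphaBar β c M₂ L m * M₁ / 2 := by positivity
  have h6 := mul_le_mul_of_nonneg_left h2 h5
  have h7 : 0 ≤ c * alphaBar β c M₂ L m * M₁ / 2 * b * (K ^ 2 * ε ^ 2) := by positivity
  linarith

end Step

/-! ### Eigenvalue truncation and its measurability. -/

section FunctionalCalculus

variable {m : ℕ} {A : Matrix (Fin m) (Fin m) ℝ}

lemma posSemidef_cfc (hA : A.IsHermitian) {g : ℝ → ℝ} (hg : ∀ t, 0 ≤ g t) :
    (cfc g A).PosSemidef := by
  rw [hA.cfc_eq, Matrix.IsHermitian.cfc, Unitary.conjStarAlgAut_apply, Matrix.star_eq_conjTranspose]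
  exact (Matrix.PosSemidef.diagonal fun i => by simpa using hg _).mul_mul_conjTranspose_same _

lemma modifyEig_sub_posSemidef (hA : A.IsHermitian) (M₁ M₂ : ℝ) :
    (modifyEig M₁ M₂ A - M₁ • (1 : Matrix (Fin m) (Fin m) ℝ)).PosSemidef := by
  have hA' : IsSelfAdjoint A := hA
  have e : modifyEig M₁ M₂ A - M₁ • (1 : Matrix (Fin m) (Fin m) ℝ) =
      cfc (fun t : ℝ => max M₁ (min t M₂) - M₁) A := by
    rw [cfc_sub _ (fun _ => M₁) A (by fun_prop) (by fun_prop), cfc_const M₁ A, modifyEig,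
      Algebra.algebraMap_eq_smul_one]
  rw [e]
  exact posSemidef_cfc hA fun t => by simp

lemma sub_modifyEig_posSemidef (hA : A.IsHermitian) {M₁ M₂ : ℝ} (h : M₁ ≤ M₂) :
    (M₂ • (1 : Matrix (Fin m) (Fin m) ℝ) - modifyEig M₁ M₂ A).PosSemidef := by
  have hA' : IsSelfAdjoint A := hA
  have e : M₂ • (1 : Matrix (Fin m) (Fin m) ℝ) - modifyEig M₁ M₂ A =
      cfc (fun t : ℝ => M₂ - max M₁ (min t M₂)) A := by
    rw [cfc_sub (fun _ => M₂) _ A (by fun_prop) (by fun_prop), cfc_const M₂ A, modifyEig,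
      Algebra.algebraMap_eq_smul_one]
  rw [e]
  exact posSemidef_cfc hA fun t => by simp [h]

/-- Besides measurability, symmetry is all that is needed of the BFGS formula: the functional
calculus then truncates the eigenvalues. -/
lemma bfgs_isHermitian {H : Matrix (Fin m) (Fin m) ℝ} (hH : Hᵀ = H) (s y : Vec m) :
    (bfgs H s y).IsHermitian := by
  rw [Matrix.IsHermitian, Matrix.conjTranspose_eq_transpose_of_trivial, bfgs]
  simp [Matrix.transpose_vecMulVec, hH, Matrix.mul_assoc]

lemma measurable_matrix_mul {α : Type*} [MeasurableSpace α] {n l k : ℕ}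
    {A : α → Matrix (Fin n) (Fin l) ℝ} {B : α → Matrix (Fin l) (Fin k) ℝ}
    (hA : ∀ i j, Measurable fun a => A a i j) (hB : ∀ i j, Measurable fun a => B a i j) (i j) :
    Measurable fun a => (A a * B a) i j := by
  simp_rw [Matrix.mul_apply]
  exact Finset.measurable_sum _ fun _ _ => (hA _ _).mul (hB _ _)

lemma measurable_matrix_aeval {α : Type*} [MeasurableSpace α] {A : α → Matrix (Fin m) (Fin m) ℝ}
    (hA : ∀ i j, Measurable fun a => A a i j) (p : Polynomial ℝ) (i j) :
    Measurable fun a => (Polynomial.aeval (A a) p) i j := by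
  have hpow : ∀ (k : ℕ) (i j), Measurable fun a => (A a ^ k) i j := by
    intro k
    induction k with
    | zero => intro i j; simp
    | succ k ih =>
      intro i j
      simp_rw [pow_succ]
      exact measurable_matrix_mul ih hA i j
  simp_rw [Polynomial.aeval_eq_sum_range, Matrix.sum_apply, Matrix.smul_apply]
  exact Finset.measurable_sum _ fun k _ => (hpow k i j).const_mul _

/-- Polynomials that converge pointwise to a continuous function. -/
lemma exists_polynomial_tendsto {g : ℝ → ℝ} (hg : Continuous g) :
    ∃ p : ℕ → Polynomial ℝ,
      ∀ t, Filter.Tendsto (fun N => (p N).eval t) Filter.atTop (nhds (g t)) := by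
  -- Weierstrass on `[-N, N]` with error `1 / (N + 1)`; every point lies in these intervals
  -- eventually.
  have h : ∀ N : ℕ, ∃ p : Polynomial ℝ, ∀ t ∈ Set.Icc (-(N : ℝ)) N,
      |p.eval t - g t| < 1 / ((N : ℝ) + 1) := fun N =>
    exists_polynomial_near_of_continuousOn _ _ g hg.continuousOn _ (by positivity)
  choose p hp using h
  refine ⟨p, fun t => ?_⟩
  rw [tendsto_iff_dist_tendsto_zero]
  obtain ⟨N₀, hN₀⟩ := exists_nat_ge |t|
  refine squeeze_zero' (.of_forall fun _ => dist_nonneg)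
    (Filter.eventually_atTop.2 ⟨N₀, fun N hN => ?_⟩) tendsto_one_div_add_atTop_nhds_zero_nat
  rw [Real.dist_eq]
  have : |t| ≤ N := hN₀.trans (by exact_mod_cast hN)
  exact (hp N t (abs_le.1 this)).le

/-- No measurable choice of eigenvectors is made: the entries are pointwise limits of entries of
polynomials in the matrix. For a fixed matrix, convergence at its finitely many eigenvalues is
enough. -/
lemma measurable_cfc {α : Type*} [MeasurableSpace α] {A : α → Matrix (Fin m) (Fin m) ℝ}
    (hA : ∀ i j, Measurable fun a => A a i j) (hH : ∀ a, (A a).IsHermitian) {g : ℝ → ℝ}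
    (hg : Continuous g) (i j) : Measurable fun a => (cfc g (A a)) i j := by
  obtain ⟨p, hp⟩ := exists_polynomial_tendsto hg
  refine measurable_of_tendsto_metrizable (fun N => measurable_matrix_aeval hA (p N) i j)
    (tendsto_pi_nhds.2 fun a => ?_)
  have hA' : IsSelfAdjoint (A a) := hH a
  simp_rw [← cfc_polynomial (R := ℝ) _ (A a) hA', (hH a).cfc_eq, Matrix.IsHermitian.cfc,
    Unitary.conjStarAlgAut_apply]
  have hc : Continuous fun w : Fin m → ℝ =>
      (((hH a).eigenvectorUnitary : Matrix (Fin m) (Fin m) ℝ) * Matrix.diagonal w *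
        star ((hH a).eigenvectorUnitary : Matrix (Fin m) (Fin m) ℝ)) i j := by
    fun_prop
  refine (hc.tendsto _).comp (tendsto_pi_nhds.2 fun l => ?_)
  simpa using hp ((hH a).eigenvalues l)

end FunctionalCalculus

/-! ### Measurability of the run. -/

section Measurability

variable {α : Type*} [MeasurableSpace α] {n m d : ℕ} {f : Vec n → ℝ} {β c M₁ M₂ : ℝ}

lemma measurable_mulE {A : α → Matrix (Fin n) (Fin d) ℝ} {v : α → Vec d}
    (hA : ∀ i j, Measurable fun a => A a i j) (hv : Measurable v) :
    Measurable fun a => mulE (A a) (v a) :=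
  measurable_mulE_of (A := fun a i j => A a i j)
    (measurable_pi_lambda _ fun i => measurable_pi_lambda _ fun j => hA i j) hv

lemma measurable_fdGrad (hf : Continuous f) {A : α → Matrix (Fin n) (Fin d) ℝ} {x : α → Vec n}
    (hA : ∀ i j, Measurable fun a => A a i j) (hx : Measurable x) (ε : ℝ) :
    Measurable fun a => fdGrad f (A a) ε (x a) := by
  refine (WithLp.measurable_toLp 2 (Fin d → ℝ)).comp (measurable_pi_lambda _ fun i => ?_)
  have h := (measurable_mulE hA (measurable_const (a := EuclideanSpace.single i (1 : ℝ)))).const_smul ε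
  exact ((hf.measurable.comp (hx.add h)).sub (hf.measurable.comp (hx.sub h))).div_const _

lemma measurable_updateP {P : α → Matrix (Fin n) (Fin m) ℝ} {u v : α → Vec n}
    (hP : ∀ i j, Measurable fun a => P a i j) (hu : Measurable u) (hv : Measurable v) (i j) :
    Measurable fun a => updateP (P a) (u a) (v a) i j := by
  simp only [updateP, Matrix.of_apply]
  split_ifs
  · exact hP _ _
  · exact (by fun_prop : Measurable fun w : Vec n => w i).comp (hu.norm.inv.smul hu)
  · exact (by fun_prop : Measurable fun w : Vec n => w i).comp (hv.norm.inv.smul hv)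

open Classical in
/-- The step size is a supremum of the admissible trial steps. -/
lemma stepSize_eq_iSup (hβ : 0 ≤ β) (hβ1 : β ≤ 1) (x : Vec n) (P : Matrix (Fin n) (Fin m) ℝ)
    (v q : Vec m) : stepSize f β c x P v q =
      ⨆ i : ℕ, if Armijo f c x P v q (β ^ i) then β ^ i else 0 := by
  have hbdd : BddAbove (Set.range fun i : ℕ =>
      if Armijo f c x P v q (β ^ i) then β ^ i else 0) := by
    refine ⟨1, ?_⟩
    rintro _ ⟨i, rfl⟩
    dsimp only
    split_ifs
    · exact pow_le_one₀ hβ hβ1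
    · exact zero_le_one
  unfold stepSize
  split_ifs with h
  -- The powers of `β` decrease, so the first accepted one is the largest.
  · refine le_antisymm ?_ (ciSup_le fun i => ?_)
    · refine le_ciSup_of_le hbdd (Nat.find h) ?_
      rw [if_pos (Nat.find_spec h)]
    · split_ifs with hi
      · exact pow_le_pow_of_le_one hβ hβ1 (Nat.find_min' h hi)
      · positivity
  · simp only [not_exists] at h
    simp [h]

lemma measurable_stepSize (hf : Continuous f) (hβ : 0 ≤ β) (hβ1 : β ≤ 1) {x : α → Vec n}
    {P : α → Matrix (Fin n) (Fin m) ℝ} {v q : α → Vec m} (hx : Measurable x)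
    (hP : ∀ i j, Measurable fun a => P a i j) (hv : Measurable v) (hq : Measurable q) :
    Measurable fun a => stepSize f β c (x a) (P a) (v a) (q a) := by
  classical
  simp_rw [stepSize_eq_iSup hβ hβ1]
  refine Measurable.iSup fun i => Measurable.ite ?_ measurable_const measurable_const
  exact measurableSet_le
    (hf.measurable.comp (hx.add ((measurable_const (a := β ^ i)).smul (measurable_mulE hP hv))))
    ((hf.measurable.comp hx).add ((hq.inner hv).const_mul _))

lemma measurable_bfgs {H : α → Matrix (Fin m) (Fin m) ℝ} {s y : α → Vec m}
    (hH : ∀ i j, Measurable fun a => H a i j) (hs : Measurable s) (hy : Measurable y) (i j) :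
    Measurable fun a => bfgs (H a) (s a) (y a) i j := by
  have hr : Measurable fun a => (inner ℝ (s a) (y a))⁻¹ := (hs.inner hy).inv
  have hcoord : ∀ {w : α → Vec m}, Measurable w → ∀ i, Measurable fun a => (w a).ofLp i :=
    fun hw i => (by fun_prop : Measurable fun w : Vec m => w i).comp hw
  have hvec : ∀ {w z : α → Vec m}, Measurable w → Measurable z → ∀ i j, Measurable fun a =>
      ((inner ℝ (s a) (y a))⁻¹ • Matrix.vecMulVec (w a).ofLp (z a).ofLp) i j := by
    intro w z hw hz i j
    simp only [Matrix.smul_apply, Matrix.vecMulVec_apply, smul_eq_mul]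
    exact hr.mul ((hcoord hw i).mul (hcoord hz j))
  have hone : ∀ {w z : α → Vec m}, Measurable w → Measurable z → ∀ i j, Measurable fun a =>
      (1 - (inner ℝ (s a) (y a))⁻¹ • Matrix.vecMulVec (w a).ofLp (z a).ofLp) i j := by
    intro w z hw hz i j
    simp only [Matrix.sub_apply]
    exact (hvec hw hz i j).const_sub _
  exact (measurable_matrix_mul (measurable_matrix_mul (hone hs hy) hH) (hone hy hs) i j).add
    (hvec hs hs i j)

lemma State.Regular.step {S : State n m} (hS : S.Regular M₁ M₂) (hM : M₁ ≤ M₂) (ε : ℝ)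
    (Q : Matrix (Fin n) (Fin d) ℝ) : (step f β c M₁ M₂ ε Q S).Regular M₁ M₂ where
  columns := norm_mulE_updateP_single_le hS.columns _ _
  lower := modifyEig_sub_posSemidef
    (bfgs_isHermitian (transpose_eq_of_sub_smul_one_posSemidef hS.lower) _ _) _ _
  upper := sub_modifyEig_posSemidef
    (bfgs_isHermitian (transpose_eq_of_sub_smul_one_posSemidef hS.lower) _ _) hM

lemma State.Regular.run {S₀ : State n m} (hS : S₀.Regular M₁ M₂) (hM : M₁ ≤ M₂) (ε : ℕ → ℝ)
    (Q : ℕ → Matrix (Fin n) (Fin d) ℝ) (k : ℕ) :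
    (run f β c M₁ M₂ S₀ ε Q k).Regular M₁ M₂ := by
  induction k with
  | zero => exact hS
  | succ k ih => exact ih.step hM _ _

/-- Measurability of all components of a random state. -/
structure MeasurableState (S : α → State n m) : Prop where
  x : Measurable fun a => (S a).x
  P : ∀ i j, Measurable fun a => (S a).P i j
  H : ∀ i j, Measurable fun a => (S a).H i j

lemma MeasurableState.step (hf : Continuous f) (hβ : 0 ≤ β) (hβ1 : β ≤ 1) {S : α → State n m}
    (hS : MeasurableState S) (hreg : ∀ a, (S a).Regular M₁ M₂) {Q : α → Matrix (Fin n) (Fin d) ℝ}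
    (hQ : ∀ i j, Measurable fun a => Q a i j) (ε : ℝ) :
    MeasurableState fun a => step f β c M₁ M₂ ε (Q a) (S a) := by
  have hP : ∀ i j, Measurable fun a =>
      updateP (S a).P (S a).x (mulE (Q a) (fdGrad f (Q a) ε (S a).x)) i j :=
    measurable_updateP hS.P hS.x (measurable_mulE hQ (measurable_fdGrad hf hQ hS.x ε))
  have hq := measurable_fdGrad hf hP hS.x ε
  have hv := (measurable_mulE hS.H hq).neg
  have hα := measurable_stepSize (c := c) hf hβ hβ1 hS.x hP hv hq
  have hx := hS.x.add (hα.smul (measurable_mulE hP hv))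
  have hy := (measurable_fdGrad hf hP hx ε).sub hq
  exact ⟨hx, hP, measurable_cfc (measurable_bfgs hS.H (hα.smul hv) hy)
    (fun a => bfgs_isHermitian (transpose_eq_of_sub_smul_one_posSemidef (hreg a).lower) _ _)
    (by fun_prop)⟩

lemma measurableState_run (hf : Continuous f) (hβ : 0 ≤ β) (hβ1 : β ≤ 1) (hM : M₁ ≤ M₂)
    {S₀ : State n m} (hS : S₀.Regular M₁ M₂) (ε : ℕ → ℝ) {Q : ℕ → α → Fin n → Fin d → ℝ} (k : ℕ)
    (hQ : ∀ i < k, Measurable (Q i)) :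
    MeasurableState fun a => run f β c M₁ M₂ S₀ ε (fun i => Matrix.of (Q i a)) k := by
  induction k with
  | zero =>
    have h0 : MeasurableState fun _ : α => S₀ :=
      ⟨measurable_const, fun _ _ => measurable_const, fun _ _ => measurable_const⟩
    exact h0
  | succ k ih =>
    refine (ih fun i hi => hQ i (by omega)).step hf hβ hβ1 (fun a => hS.run hM _ _ _)
      (fun i j => ?_) _
    have := hQ k (by omega)
    simp only [Matrix.of_apply]
    fun_prop

/-- The σ-algebra is an explicit argument so that it can be the one generated by the first `k`
sampled matrices. -/
lemma measurable_run_x {α : Type*} (mα : MeasurableSpace α) (hf : Continuous f) (hβ : 0 ≤ β)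
    (hβ1 : β ≤ 1) (hM : M₁ ≤ M₂) {S₀ : State n m} (hS : S₀.Regular M₁ M₂) (ε : ℕ → ℝ)
    {Q : ℕ → α → Fin n → Fin d → ℝ} (k : ℕ) (hQ : ∀ i < k, Measurable (Q i)) :
    Measurable fun a => (run f β c M₁ M₂ S₀ ε (fun i => Matrix.of (Q i a)) k).x :=
  (measurableState_run hf hβ hβ1 hM hS ε k hQ).x

end Measurability

/-! ### The probability that a Gaussian matrix captures a given vector. -/

section Capture

variable {n d : ℕ}

/-- The Gaussian matrices that are bounded and do not shorten `g` too much. -/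
def captureSet (n d : ℕ) (a B : ℝ) (g : Vec n) : Set (Fin n → Fin d → ℝ) :=
  {Q | a * d * ‖g‖ ^ 2 ≤ ‖mulE (Matrix.of Q)ᵀ g‖ ^ 2 ∧
    ∀ w, ‖mulE (Matrix.of Q)ᵀ w‖ ^ 2 ≤ B * ‖w‖ ^ 2}

lemma continuous_mulE_transpose_of (w : Vec n) :
    Continuous fun Q : Fin n → Fin d → ℝ => mulE (Matrix.of Q)ᵀ w := by
  refine (PiLp.continuous_toLp 2 fun _ : Fin d => ℝ).comp
    (f := fun Q i => mulE (Matrix.of Q)ᵀ w i) (continuous_pi fun i => ?_)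
  simp only [mulE_apply, Matrix.transpose_apply, Matrix.of_apply]
  fun_prop

/-- Uncountably many conditions, but each is closed in `Q`. -/
lemma measurableSet_transpose_bounded (B : ℝ) :
    MeasurableSet {Q : Fin n → Fin d → ℝ | ∀ w, ‖mulE (Matrix.of Q)ᵀ w‖ ^ 2 ≤ B * ‖w‖ ^ 2} := by
  rw [Set.ofPred_forall]
  exact (isClosed_iInter fun w => isClosed_le
    ((continuous_mulE_transpose_of w).norm.pow 2) continuous_const).measurableSet

lemma measurableSet_captureSet_prod (a B : ℝ) :
    MeasurableSet {z : Vec n × (Fin n → Fin d → ℝ) | z.2 ∈ captureSet n d a B z.1} :=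
  (measurableSet_le (by fun_prop)
    ((measurable_mulE_transpose_of measurable_snd measurable_fst).norm.pow_const 2)).inter
    ((measurableSet_transpose_bounded B).preimage measurable_snd)

lemma add_sub_one_le_measureReal_inter {α : Type*} [MeasurableSpace α] {μ : Measure α}
    [IsProbabilityMeasure μ] (A : Set α) {B : Set α} (hB : MeasurableSet B) :
    μ.real A + μ.real B - 1 ≤ μ.real (A ∩ B) := by
  have h1 := measureReal_union_add_inter (μ := μ) (s := A) hB
  have h2 : μ.real (A ∪ B) ≤ 1 := measureReal_le_one
  linarith

lemma norm_sq_mulE_transpose_le_of_norm_le (A : Matrix (Fin n) (Fin d) ℝ) {B : ℝ}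
    (h : ‖Matrix.toEuclideanCLM (n := Fin n) (𝕜 := ℝ) (A * Aᵀ)‖ ≤ B) (w : Vec n) :
    ‖mulE Aᵀ w‖ ^ 2 ≤ B * ‖w‖ ^ 2 := by
  rw [← real_inner_self_eq_norm_sq, inner_mulE_transpose, mulE_mulE,
    ← toEuclideanCLM_apply_eq_mulE]
  refine (real_inner_le_norm _ _).trans ?_
  have := (ContinuousLinearMap.le_opNorm
    (Matrix.toEuclideanCLM (n := Fin n) (𝕜 := ℝ) (A * Aᵀ)) w).trans
    (mul_le_mul_of_nonneg_right h (norm_nonneg w))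
  nlinarith [norm_nonneg w]

variable {C₀ C : ℝ}

lemma IsGaussianConstants.bounded_prob (h : IsGaussianConstants C₀ C) (hd : 0 < d) (hdn : d ≤ n) :
    1 - 2 * Real.exp (-(d : ℝ)) ≤ (gaussianMatrix n d).real
      {Q | ∀ w, ‖mulE (Matrix.of Q)ᵀ w‖ ^ 2 ≤ C * n * ‖w‖ ^ 2} := by
  have hd' : (0 : ℝ) < d := by exact_mod_cast hd
  refine (h.operator n d hdn).trans (measureReal_mono fun Q hQ => ?_)
  simp only [Set.mem_ofPred_eq] at hQ ⊢
  rw [one_div, inv_mul_le_iff₀ hd'] at hQ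
  have : (d : ℝ) * (C * (n / d)) = C * n := by field_simp
  rw [this] at hQ
  exact norm_sq_mulE_transpose_le_of_norm_le _ hQ

lemma IsGaussianConstants.lower_prob (h : IsGaussianConstants C₀ C) (hd : 0 < d) {ϵ : ℝ}
    (h0 : 0 < ϵ) (h1 : ϵ < 1) (g : Vec n) :
    1 - 2 * Real.exp (-C₀ * ϵ ^ 2 * d) ≤ (gaussianMatrix n d).real
      {Q | (1 - ϵ) * d * ‖g‖ ^ 2 ≤ ‖mulE (Matrix.of Q)ᵀ g‖ ^ 2} := by
  have hd' : (0 : ℝ) < d := by exact_mod_cast hd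
  refine (h.vector n d g ϵ h0 h1).trans (measureReal_mono fun Q hQ => ?_)
  simp only [Set.mem_ofPred_eq] at hQ ⊢
  have := hQ.1
  rw [norm_sq_one_div_sqrt_smul, le_div_iff₀ hd'] at this
  linarith

lemma captureSet_prob_ge (h : IsGaussianConstants C₀ C) (hd : 0 < d) (hdn : d ≤ n) (a : ℝ)
    (g : Vec n) :
    (gaussianMatrix n d).real {Q | a * d * ‖g‖ ^ 2 ≤ ‖mulE (Matrix.of Q)ᵀ g‖ ^ 2} -
      2 * Real.exp (-(d : ℝ)) ≤ (gaussianMatrix n d).real (captureSet n d a (C * n) g) := by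
  have h1 := add_sub_one_le_measureReal_inter (μ := gaussianMatrix n d)
    {Q | a * d * ‖g‖ ^ 2 ≤ ‖mulE (Matrix.of Q)ᵀ g‖ ^ 2}
    (measurableSet_transpose_bounded (n := n) (d := d) (C * n))
  have h2 := h.bounded_prob hd hdn
  have e : captureSet n d a (C * n) g =
      {Q | a * d * ‖g‖ ^ 2 ≤ ‖mulE (Matrix.of Q)ᵀ g‖ ^ 2} ∩
        {Q | ∀ w, ‖mulE (Matrix.of Q)ᵀ w‖ ^ 2 ≤ C * n * ‖w‖ ^ 2} := rfl
  rw [e]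
  linarith

lemma exp_neg_le_one_div {y : ℝ} (hy : 4 ≤ y) : Real.exp (-y) ≤ 1 / 5 := by
  rw [Real.exp_neg, ← one_div]
  exact one_div_le_one_div_of_le (by norm_num) (by linarith [Real.add_one_le_exp y])

/-- For a large square matrix and a unit vector, both concentration bounds hold at once with
positive probability, whence `1 - ϵ ≤ C`; with `ϵ = (1 - C)/2` this refutes `C < 1`. It is what
gives `d ≤ C n`. -/
lemma IsGaussianConstants.one_le (h : IsGaussianConstants C₀ C) : 1 ≤ C := by
  by_contra! hC
  have hCpos := h.pos
  have hC₀ := h.pos₀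
  set ϵ := (1 - C) / 2 with hϵ
  have hϵ0 : 0 < ϵ := by linarith
  -- Large enough for both exponentials to be at most `1/5`, so that the joint probability is at
  -- least `1 - 4/5`.
  obtain ⟨N, hN⟩ := exists_nat_gt (4 / (C₀ * ϵ ^ 2) + 4)
  have hq : 0 < 4 / (C₀ * ϵ ^ 2) := by positivity
  have hN4 : (4 : ℝ) ≤ N := by linarith
  have hN0 : 0 < N := by
    rw [← Nat.cast_pos (α := ℝ)]; linarith
  have hNε : 4 ≤ C₀ * ϵ ^ 2 * N := by
    have : 4 / (C₀ * ϵ ^ 2) ≤ N := by linarith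
    rw [div_le_iff₀ (by positivity)] at this
    linarith
  have e1 := exp_neg_le_one_div hN4
  have e2 := exp_neg_le_one_div hNε
  set g : Vec N := EuclideanSpace.single ⟨0, hN0⟩ 1
  have hg : ‖g‖ = 1 := by simp [g]
  have h1 := h.lower_prob (n := N) hN0 hϵ0 (by linarith) g
  have h2 := captureSet_prob_ge h hN0 le_rfl (1 - ϵ) g
  rw [neg_mul, neg_mul] at h1
  have h3 : 0 < (gaussianMatrix N N).real (captureSet N N (1 - ϵ) (C * N) g) := by linarith
  obtain ⟨Q, hQ1, hQ2⟩ := nonempty_of_measureReal_ne_zero h3.ne'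
  have h4 := hQ1.trans (hQ2 g)
  rw [hg] at h4
  have : (1 - ϵ) ≤ C := by nlinarith
  linarith

/-- Lower-tail Chernoff bound with `s ‖g‖² = -256`: the failure probability is at most the `d`-th
power of `e^(1/2) / √257 < 11/100`. -/
lemma gaussianMatrix_small_ball (hd : 0 < d) (g : Vec n) :
    89 / 100 ≤ (gaussianMatrix n d).real
      {Q | 1 / 256 * d * ‖g‖ ^ 2 ≤ ‖mulE (Matrix.of Q)ᵀ g‖ ^ 2} := by
  rcases eq_or_ne g 0 with rfl | hg
  · have : {Q : Fin n → Fin d → ℝ |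
        1 / 256 * d * ‖(0 : Vec n)‖ ^ 2 ≤ ‖mulE (Matrix.of Q)ᵀ (0 : Vec n)‖ ^ 2} = Set.univ := by
      ext Q; simp [mulE_zero]
    rw [this, probReal_univ]
    norm_num
  have hg' : 0 < ‖g‖ ^ 2 := by positivity
  have e1 : -256 / ‖g‖ ^ 2 * ‖g‖ ^ 2 = -256 := by field_simp
  have ht := gaussianMatrix_norm_sq_tail n d g (-256 / ‖g‖ ^ 2) (1 / 256 * d * ‖g‖ ^ 2)
    (by rw [e1]; norm_num)
  have hu := one_le_measureReal_add_of_univ_subset (μ := gaussianMatrix n d)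
    (G := {Q | 1 / 256 * d * ‖g‖ ^ 2 ≤ ‖mulE (Matrix.of Q)ᵀ g‖ ^ 2})
    (A := {Q | -256 / ‖g‖ ^ 2 * (1 / 256 * d * ‖g‖ ^ 2) ≤
      -256 / ‖g‖ ^ 2 * ‖mulE (Matrix.of Q)ᵀ g‖ ^ 2}) (by
      intro Q _
      simp only [Set.mem_union, Set.mem_ofPred_eq]
      rcases le_total (1 / 256 * d * ‖g‖ ^ 2) (‖mulE (Matrix.of Q)ᵀ g‖ ^ 2) with hle | hle
      · exact Or.inl hle
      · exact Or.inr (mul_le_mul_of_nonpos_left hle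
          (div_nonpos_of_nonpos_of_nonneg (by norm_num) hg'.le)))
  rw [e1] at ht
  have e2 : -(-256 / ‖g‖ ^ 2 * (1 / 256 * d * ‖g‖ ^ 2) / 2) = d * (1 / 2 : ℝ) := by
    field_simp
  have e3 : Real.exp (1 / 2) ≤ 1.65 := by
    have : Real.exp (1 / 2) ^ 2 = Real.exp 1 := by rw [← Real.exp_nat_mul]; norm_num
    nlinarith [Real.exp_one_lt_d9, Real.exp_pos (1 / 2)]
  have e4 : 1 / √(1 - -256) ≤ (1 / 16 : ℝ) :=
    one_div_le_one_div_of_le (by norm_num) (Real.le_sqrt_of_sq_le (by norm_num))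
  have e5 : Real.exp (1 / 2) * (1 / √(1 - -256)) ≤ 11 / 100 :=
    (mul_le_mul e3 e4 (by positivity) (by norm_num)).trans (by norm_num)
  rw [e2, Real.exp_nat_mul, ← mul_pow] at ht
  have e6 : (Real.exp (1 / 2) * (1 / √(1 - -256))) ^ d ≤ 11 / 100 :=
    (pow_le_of_le_one (by positivity) (by linarith) hd.ne').trans e5
  linarith

lemma pos_of_successProb_pos {ϵ : ℝ} (hp : 0 < successProb C₀ ϵ d) : 0 < d := by
  rcases Nat.eq_zero_or_pos d with rfl | h
  · simp [successProb] at hp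
    norm_num at hp
  · exact h

/-- With at least half of the success probability, a Gaussian matrix captures any given vector;
the fraction that is captured does not degenerate as `ϵ` tends to `1`. -/
lemma exists_captureSet_prob (h : IsGaussianConstants C₀ C) (hdn : d ≤ n) {ϵ : ℝ} (h0 : 0 < ϵ)
    (h1 : ϵ < 1) (hp : 0 < successProb C₀ ϵ d) :
    ∃ a, 1 - ϵ ≤ a ∧ 1 / 256 ≤ a ∧
      ∀ g, successProb C₀ ϵ d / 2 ≤ (gaussianMatrix n d).real (captureSet n d a (C * n) g) := by
  have hd := pos_of_successProb_pos hp
  rcases le_total (1 / 256) (1 - ϵ) with hle | hle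
  · refine ⟨1 - ϵ, le_rfl, hle, fun g => ?_⟩
    have e1 := h.lower_prob (n := n) hd h0 h1 g
    have e2 := captureSet_prob_ge h hd hdn (1 - ϵ) g
    unfold successProb at hp ⊢
    linarith
  · refine ⟨1 / 256, hle, le_rfl, fun g => ?_⟩
    have e1 := gaussianMatrix_small_ball (n := n) hd g
    have e2 := captureSet_prob_ge h hd hdn (1 / 256) g
    -- This makes `89/100 - 2 exp (-d)` at least `1/2 - exp (-d)`, hence at least half of
    -- `successProb`.
    have e3 : Real.exp (-(d : ℝ)) ≤ 39 / 100 := by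
      have hd' : (1 : ℝ) ≤ d := by exact_mod_cast hd
      refine (Real.exp_le_exp.2 (neg_le_neg hd')).trans ?_
      rw [Real.exp_neg, inv_le_comm₀ (Real.exp_pos _) (by norm_num)]
      linarith [Real.exp_one_gt_d9]
    have e4 := Real.exp_pos (-C₀ * ϵ ^ 2 * d)
    unfold successProb
    linarith

end Capture

/-! ### Conditioning on the current iterate. -/

/-- A lower bound for an expectation, by conditioning on the first of two independent variables. -/
lemma mul_integral_le_integral_indicator {Ω 𝒳 𝒴 : Type*} [MeasurableSpace Ω] [MeasurableSpace 𝒳]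
    [MeasurableSpace 𝒴] {μ : Measure Ω} [IsProbabilityMeasure μ] {X : Ω → 𝒳} {Y : Ω → 𝒴}
    (hX : Measurable X) (hY : Measurable Y) (hXY : IndepFun X Y μ) {E : Set (𝒳 × 𝒴)}
    (hE : MeasurableSet E) {φ : 𝒳 → ℝ} (hφ : Measurable φ) (hφ0 : ∀ x, 0 ≤ φ x)
    (hint : Integrable (fun ω => φ (X ω)) μ) {r : ℝ}
    (hr : ∀ x, r ≤ (μ.map Y).real {y | (x, y) ∈ E}) :
    r * ∫ ω, φ (X ω) ∂μ ≤ ∫ ω, E.indicator (fun z => φ z.1) (X ω, Y ω) ∂μ := by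
  have : IsProbabilityMeasure (μ.map X) := Measure.isProbabilityMeasure_map hX.aemeasurable
  have : IsProbabilityMeasure (μ.map Y) := Measure.isProbabilityMeasure_map hY.aemeasurable
  have hmap := (indepFun_iff_map_prod_eq_prod_map_map hX.aemeasurable hY.aemeasurable).1 hXY
  have hφX : Integrable φ (μ.map X) :=
    (integrable_map_measure hφ.aestronglyMeasurable hX.aemeasurable).2 hint
  have hind : Integrable (E.indicator fun z => φ z.1) ((μ.map X).prod (μ.map Y)) :=
    (hφX.comp_fst _).indicator hE
  have hmeas : Measurable (E.indicator fun z : 𝒳 × 𝒴 => φ z.1) :=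
    (hφ.comp measurable_fst).indicator hE
  rw [← integral_map (φ := fun ω => (X ω, Y ω)) (hX.prodMk hY).aemeasurable
    hmeas.aestronglyMeasurable, hmap, integral_prod _ hind,
    ← integral_map (φ := X) hX.aemeasurable hφ.aestronglyMeasurable, ← integral_const_mul]
  refine integral_mono (hφX.const_mul r) hind.integral_prod_left fun x => ?_
  have e : (fun y => E.indicator (fun z => φ z.1) (x, y)) =
      {y | (x, y) ∈ E}.indicator fun _ => φ x := by
    ext y
    simp [Set.indicator]
  dsimp only
  have hEx : MeasurableSet {y | (x, y) ∈ E} := measurable_prodMk_left hE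
  rw [e, integral_indicator_const _ hEx, smul_eq_mul]
  exact mul_le_mul_of_nonneg_right (hr x) (hφ0 x)

/-! ### Expected decrease along the run and the bound on the minimal gradient. -/

section Run

variable {n m d : ℕ} {f : Vec n → ℝ} {β c M₁ M₂ : ℝ} {S₀ : State n m} {ε : ℕ → ℝ}

lemma run_descent (hβ : 0 ≤ β) (hc : 0 ≤ c) (hM₁ : 0 ≤ M₁) (hM : M₁ ≤ M₂)
    (hS : S₀.Regular M₁ M₂) (Q : ℕ → Matrix (Fin n) (Fin d) ℝ) (k : ℕ) :
    f (run f β c M₁ M₂ S₀ ε Q k).x ≤ f S₀.x := by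
  induction k with
  | zero => exact le_rfl
  | succ k ih => exact (step_descent hβ hc hM₁ (hS.run hM _ _ k) _ _).trans ih

lemma minGrad_nonneg (Q : ℕ → Matrix (Fin n) (Fin d) ℝ) (k : ℕ) :
    0 ≤ minGrad f β c M₁ M₂ S₀ ε Q k :=
  Finset.le_inf' _ _ fun _ _ => norm_nonneg _

lemma minGrad_le (Q : ℕ → Matrix (Fin n) (Fin d) ℝ) {j k : ℕ} (h : j ≤ k) :
    minGrad f β c M₁ M₂ S₀ ε Q k ≤ ‖gradient f (run f β c M₁ M₂ S₀ ε Q j).x‖ :=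
  Finset.inf'_le _ (Finset.mem_range.2 (by omega))

lemma measurable_inf'_apply {ι α : Type*} [MeasurableSpace α] {s : Finset ι} (hs : s.Nonempty)
    {g : ι → α → ℝ} (hg : ∀ i ∈ s, Measurable (g i)) :
    Measurable fun a => s.inf' hs fun i => g i a := by
  have h := Finset.inf'_induction hs g (p := Measurable) (fun _ h₁ _ h₂ => h₁.inf h₂) hg
  convert h using 1
  ext a
  simp [Finset.inf'_apply]

variable {Ω : Type*} [MeasurableSpace Ω] {μ : Measure Ω} {Q : ℕ → Ω → Fin n → Fin d → ℝ}

/-- The state before an iteration is independent of the matrix sampled in it. -/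
lemma indepFun_run (hf : Continuous f) (hβ : 0 ≤ β) (hβ1 : β ≤ 1) (hM : M₁ ≤ M₂)
    (hS : S₀.Regular M₁ M₂) (hQ : ∀ k, Measurable (Q k)) (hind : iIndepFun Q μ) (k : ℕ) :
    IndepFun (fun ω => (run f β c M₁ M₂ S₀ ε (fun i => Matrix.of (Q i ω)) k).x) (Q k) μ := by
  -- The `k`-th iterate is measurable for the σ-algebra of the matrices with index below `k`, which
  -- is independent of `Q k`.
  have h := indep_iSup_of_disjoint (fun i => (hQ i).comap_le) hind
    (S := Set.Iio k) (T := {k}) (by simp)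
  have hm : ∀ i < k, Measurable[⨆ i ∈ Set.Iio k, MeasurableSpace.comap (Q i) inferInstance] (Q i) :=
    fun i hi => (comap_measurable (Q i)).mono (le_iSup₂_of_le i hi le_rfl) le_rfl
  have hx := measurable_run_x (c := c) (⨆ i ∈ Set.Iio k, MeasurableSpace.comap (Q i) inferInstance)
    hf hβ hβ1 hM hS ε k hm
  refine indep_of_indep_of_le_left (indep_of_indep_of_le_right h ?_) hx.comap_le
  simp

lemma measurable_minGrad (hf : Continuous f) (hg : Continuous (gradient f)) (hβ : 0 ≤ β)
    (hβ1 : β ≤ 1) (hM : M₁ ≤ M₂) (hS : S₀.Regular M₁ M₂) (hQ : ∀ k, Measurable (Q k)) (k : ℕ) :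
    Measurable fun ω => minGrad f β c M₁ M₂ S₀ ε (fun i => Matrix.of (Q i ω)) k :=
  measurable_inf'_apply _ fun j _ =>
    (hg.measurable.comp (measurable_run_x _ hf hβ hβ1 hM hS ε j fun i _ => hQ i)).norm

lemma continuous_gradient_of_lipschitz {L : ℝ}
    (hL : ∀ u v, ‖gradient f u - gradient f v‖ ≤ L * ‖u - v‖) : Continuous (gradient f) :=
  (LipschitzWith.of_dist_le_mul (K := L.toNNReal) fun u v => by
    rw [dist_eq_norm, dist_eq_norm]
    exact (hL u v).trans (mul_le_mul_of_nonneg_right (Real.le_coe_toNNReal L)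
      (norm_nonneg _))).continuous

lemma integrable_objective [IsProbabilityMeasure μ] (hf : Continuous f)
    (hb : BddBelow (Set.range f)) (hβ : 0 ≤ β) (hβ1 : β ≤ 1) (hc : 0 ≤ c) (hM₁ : 0 ≤ M₁)
    (hM : M₁ ≤ M₂) (hS : S₀.Regular M₁ M₂) (hQ : ∀ k, Measurable (Q k)) (k : ℕ) :
    Integrable (fun ω => f (run f β c M₁ M₂ S₀ ε (fun i => Matrix.of (Q i ω)) k).x) μ :=
  Integrable.of_mem_Icc (⨅ x, f x) (f S₀.x)
    (hf.measurable.comp (measurable_run_x _ hf hβ hβ1 hM hS ε k fun i _ => hQ i)).aemeasurable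
    (.of_forall fun _ => ⟨ciInf_le hb _, run_descent hβ hc hM₁ hM hS _ k⟩)

lemma integrable_minGrad_pow [IsProbabilityMeasure μ] (hf : Continuous f)
    (hg : Continuous (gradient f)) (hβ : 0 ≤ β) (hβ1 : β ≤ 1) (hM : M₁ ≤ M₂)
    (hS : S₀.Regular M₁ M₂) (hQ : ∀ k, Measurable (Q k)) (k r : ℕ) :
    Integrable
      (fun ω => minGrad f β c M₁ M₂ S₀ ε (fun i => Matrix.of (Q i ω)) k ^ r) μ :=
  Integrable.of_mem_Icc 0 (‖gradient f S₀.x‖ ^ r)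
    ((measurable_minGrad hf hg hβ hβ1 hM hS hQ k).pow_const r).aemeasurable
    (.of_forall fun _ => ⟨pow_nonneg (minGrad_nonneg _ k) r,
      pow_le_pow_left₀ (minGrad_nonneg _ k) (minGrad_le _ (Nat.zero_le k)) r⟩)

/-- The decrease of `step_decrease` occurs on the capture event, whose conditional probability given
the iterate is at least half of `successProb`; elsewhere `f` does not increase. The minimal gradient
replaces the current one so that the left side can be summed over `j`. -/
lemma expected_decrease [IsProbabilityMeasure μ] {L C₀ C ϵ : ℝ}
    (hC : IsGaussianConstants C₀ C) (hm : 2 ≤ m) (hdn : d ≤ n)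
    (hf : Differentiable ℝ f) (hL0 : 0 < L)
    (hL : ∀ u v, ‖gradient f u - gradient f v‖ ≤ L * ‖u - v‖) (hb : BddBelow (Set.range f))
    (hβ : 0 < β) (hβ1 : β < 1) (hc : 0 < c) (hc2 : c < 1 / 2) (hM₁ : 0 < M₁) (hM₂ : 0 < M₂)
    (hS : S₀.Regular M₁ M₂) (hQ : ∀ k, Measurable (Q k))
    (hlaw : ∀ k, μ.map (Q k) = gaussianMatrix n d) (hind : iIndepFun Q μ)
    (h0 : 0 < ϵ) (h1 : ϵ < 1) (hp : 0 < successProb C₀ ϵ d) (hε : ∀ k, 0 < ε k) {j k : ℕ}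
    (hj : j ≤ k) :
    decreaseConst C₀ C ϵ β c M₁ M₂ L n m d *
      (∫ ω, minGrad f β c M₁ M₂ S₀ ε (fun i => Matrix.of (Q i ω)) k ^ 2 ∂μ -
        biasConst C ϵ c M₁ M₂ L n m d ^ 2 * ε j ^ 2) ≤
    ∫ ω, f (run f β c M₁ M₂ S₀ ε (fun i => Matrix.of (Q i ω)) j).x ∂μ -
      ∫ ω, f (run f β c M₁ M₂ S₀ ε (fun i => Matrix.of (Q i ω)) (j + 1)).x ∂μ := by
  have hg := continuous_gradient_of_lipschitz hL
  have hM := spectral_bounds_le (by omega) hS.lower hS.upper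
  obtain ⟨a, ha, ha', hprob⟩ := exists_captureSet_prob hC hdn h0 h1 hp
  set K := biasConst C ϵ c M₁ M₂ L n m d
  set κ := c * alphaBar β c M₂ L m * M₁ / 2 * ((1 - ϵ) * d / (3 * C * n)) ^ 2 with hκ
  have hα0 : 0 ≤ alphaBar β c M₂ L m := le_min zero_le_one (by
    have : 0 < 1 - 2 * c := by linarith
    positivity)
  have hκ0 : 0 ≤ κ := by positivity
  have hdec : decreaseConst C₀ C ϵ β c M₁ M₂ L n m d = κ * (successProb C₀ ϵ d / 2) := by
    rw [hκ, decreaseConst]; ring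
  set X : ℕ → Ω → Vec n := fun j ω => (run f β c M₁ M₂ S₀ ε (fun i => Matrix.of (Q i ω)) j).x
    with hX
  change _ ≤ ∫ ω, f (X j ω) ∂μ - ∫ ω, f (X (j + 1) ω) ∂μ
  have hXm : ∀ j, Measurable (X j) := fun j =>
    measurable_run_x _ hf.continuous hβ.le hβ1.le hM hS ε j fun i _ => hQ i
  -- The positive part, because the conditioning bound needs a nonnegative function.
  let φ : Vec n → ℝ := fun x => max 0 (‖gradient f x‖ ^ 2 - K ^ 2 * ε j ^ 2)
  have hφ : Measurable φ :=
    (continuous_const.max ((hg.norm.pow 2).sub continuous_const)).measurable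
  have hφ0 : ∀ x, 0 ≤ φ x := fun x => le_max_left _ _
  set B := 2 * L * (f S₀.x - ⨅ x, f x) with hB
  have hφB : ∀ ω, φ (X j ω) ≤ B := fun ω => by
    have e1 := gradient_norm_sq_le hf hL0 hL hb (X j ω)
    have e2 : f (X j ω) ≤ f S₀.x := run_descent hβ.le hc.le hM₁.le hM hS _ j
    have e3 : ‖gradient f (X j ω)‖ ^ 2 ≤ B := e1.trans (by rw [hB]; gcongr)
    have e4 : 0 ≤ K ^ 2 * ε j ^ 2 := by positivity
    exact max_le ((sq_nonneg _).trans e3) (by linarith)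
  have hφint : Integrable (fun ω => φ (X j ω)) μ :=
    Integrable.of_mem_Icc 0 B (hφ.comp (hXm j)).aemeasurable
      (.of_forall fun ω => ⟨hφ0 _, hφB ω⟩)
  let E : Set (Vec n × (Fin n → Fin d → ℝ)) :=
    (fun z => (gradient f z.1, z.2)) ⁻¹' {z | z.2 ∈ captureSet n d a (C * n) z.1}
  have hE : MeasurableSet E := ((hg.measurable.comp measurable_fst).prodMk measurable_snd)
    (measurableSet_captureSet_prod a (C * n))
  have hindE : Integrable (fun ω => E.indicator (fun z => φ z.1) (X j ω, Q j ω)) μ := by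
    have hm1 : Measurable (E.indicator fun z => φ z.1) := (hφ.comp measurable_fst).indicator hE
    have hm2 := hm1.comp ((hXm j).prodMk (hQ j))
    have hle : ∀ ω, E.indicator (fun z => φ z.1) (X j ω, Q j ω) ∈ Set.Icc 0 B := fun ω =>
      ⟨Set.indicator_nonneg (fun z _ => hφ0 z.1) _,
        (Set.indicator_le_self' (fun z _ => hφ0 z.1) _).trans (hφB ω)⟩
    exact Integrable.of_mem_Icc 0 B hm2.aemeasurable (.of_forall hle)
  have hcond := mul_integral_le_integral_indicator (hXm j) (hQ j)
    (indepFun_run hf.continuous hβ.le hβ1.le hM hS hQ hind j) hE hφ hφ0 hφint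
    (r := successProb C₀ ϵ d / 2) (fun x => by rw [hlaw]; exact hprob (gradient f x))
  have hpoint : ∀ ω, κ * E.indicator (fun z => φ z.1) (X j ω, Q j ω) ≤
      f (X j ω) - f (X (j + 1) ω) := by
    intro ω
    have hR := hS.run (f := f) (β := β) (c := c) hM ε (fun i => Matrix.of (Q i ω)) j
    have e1 : f (X (j + 1) ω) ≤ f (X j ω) :=
      step_descent hβ.le hc.le hM₁.le hR (ε j) (Matrix.of (Q j ω))
    by_cases hmem : (X j ω, Q j ω) ∈ E
    · have hmem' : Q j ω ∈ captureSet n d a (C * n) (gradient f (X j ω)) := hmem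
      rw [Set.indicator_of_mem hmem]
      have e2 : f (X (j + 1) ω) ≤ f (X j ω) -
          κ * (‖gradient f (X j ω)‖ ^ 2 - K ^ 2 * ε j ^ 2) :=
        step_decrease hf hL0 hL hβ hβ1 hc hc2 hM₁ hM₂ hC.one_le (pos_of_successProb_pos hp) hdn hm
          h0 h1 ha ha' (hε j) hR (Matrix.of (Q j ω)) hmem'.1 hmem'.2
      simp only [φ]
      rw [mul_max_of_nonneg _ _ hκ0, mul_zero]
      exact max_le (by linarith) (by linarith)
    · rw [Set.indicator_of_notMem hmem]
      linarith
  have hfint : ∀ j, Integrable (fun ω => f (X j ω)) μ := fun j =>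
    integrable_objective hf.continuous hb hβ.le hβ1.le hc.le hM₁.le hM hS hQ j
  have hmono := integral_mono (hindE.const_mul κ) ((hfint j).sub (hfint (j + 1))) hpoint
  rw [integral_const_mul, integral_sub' (hfint j) (hfint (j + 1))] at hmono
  have hmin2 := integrable_minGrad_pow (c := c) (ε := ε) (μ := μ) hf.continuous hg hβ.le hβ1.le hM
    hS hQ k 2
  have hminφ : ∫ ω, minGrad f β c M₁ M₂ S₀ ε (fun i => Matrix.of (Q i ω)) k ^ 2 ∂μ -
      K ^ 2 * ε j ^ 2 ≤ ∫ ω, φ (X j ω) ∂μ := by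
    have e : K ^ 2 * ε j ^ 2 = ∫ _, K ^ 2 * ε j ^ 2 ∂μ := by simp
    rw [e, ← integral_sub hmin2 (integrable_const _)]
    have hle : ∀ ω, minGrad f β c M₁ M₂ S₀ ε (fun i => Matrix.of (Q i ω)) k ^ 2 -
        K ^ 2 * ε j ^ 2 ≤ φ (X j ω) := fun ω =>
      le_max_of_le_right (sub_le_sub_right
        (pow_le_pow_left₀ (minGrad_nonneg _ k) (minGrad_le _ hj) 2) _)
    exact integral_mono (hmin2.sub (integrable_const _)) hφint hle
  have hp2 : 0 ≤ successProb C₀ ϵ d / 2 := by positivity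
  have hfin := mul_le_mul_of_nonneg_left ((mul_le_mul_of_nonneg_left hminφ hp2).trans hcond) hκ0
  rw [hdec, mul_assoc]
  exact hfin.trans hmono

lemma decreaseConst_pos {L C₀ C ϵ : ℝ} (hC : 0 < C) (hm : 0 < m) (hdn : d ≤ n) (hL0 : 0 < L)
    (hβ : 0 < β) (hc : 0 < c) (hc2 : c < 1 / 2) (hM₁ : 0 < M₁) (hM₂ : 0 < M₂) (h1 : ϵ < 1)
    (hp : 0 < successProb C₀ ϵ d) : 0 < decreaseConst C₀ C ϵ β c M₁ M₂ L n m d := by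
  have hd := pos_of_successProb_pos hp
  have hn : 0 < n := by omega
  have h2 : 0 < 1 - 2 * c := by linarith
  have h3 : 0 < 1 - ϵ := by linarith
  have hα : 0 < alphaBar β c M₂ L m := lt_min one_pos (by positivity)
  unfold decreaseConst
  positivity

/-- The bound on the expected minimal gradient norm, for arbitrary precisions. -/
lemma expected_minGrad_le [IsProbabilityMeasure μ] {L C₀ C ϵ : ℝ}
    (hC : IsGaussianConstants C₀ C) (hm : 2 ≤ m) (hdn : d ≤ n)
    (hf : Differentiable ℝ f) (hL0 : 0 < L)
    (hL : ∀ u v, ‖gradient f u - gradient f v‖ ≤ L * ‖u - v‖) (hb : BddBelow (Set.range f))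
    (hβ : 0 < β) (hβ1 : β < 1) (hc : 0 < c) (hc2 : c < 1 / 2) (hM₁ : 0 < M₁) (hM₂ : 0 < M₂)
    (hS : S₀.Regular M₁ M₂) (hlaw : ∀ k, HasLaw (Q k) (gaussianMatrix n d) μ)
    (hind : iIndepFun Q μ)
    (h0 : 0 < ϵ) (h1 : ϵ < 1) (hp : 0 < successProb C₀ ϵ d) (hε : ∀ k, 0 < ε k) (k : ℕ) :
    Integrable (fun ω => minGrad f β c M₁ M₂ S₀ ε (fun i => Matrix.of (Q i ω)) k) μ ∧
      ∫ ω, minGrad f β c M₁ M₂ S₀ ε (fun i => Matrix.of (Q i ω)) k ∂μ ≤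
      √(1 / ((k : ℝ) + 1) * (decreaseConst C₀ C ϵ β c M₁ M₂ L n m d)⁻¹ * (f S₀.x - ⨅ x, f x) +
        biasConst C ϵ c M₁ M₂ L n m d ^ 2 * (∑ j ∈ Finset.range (k + 1), ε j ^ 2) /
          ((k : ℝ) + 1)) := by
  -- `HasLaw` gives measurability only almost everywhere. Measurable modifications keep laws and
  -- independence, and change the run on a null set only.
  wlog hQ : ∀ k, Measurable (Q k) generalizing Q
  · let Q' : ℕ → Ω → Fin n → Fin d → ℝ := fun k => (hlaw k).aemeasurable.mk (Q k)
    have hae : ∀ k, Q k =ᵐ[μ] Q' k := fun k => (hlaw k).aemeasurable.ae_eq_mk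
    have hQ' : ∀ k, Measurable (Q' k) := fun k => (hlaw k).aemeasurable.measurable_mk
    have h := this (Q := Q')
      (fun k => ⟨(hQ' k).aemeasurable, by rw [← Measure.map_congr (hae k), (hlaw k).map_eq]⟩)
      (hind.congr hae) hQ'
    have heq : (fun ω => minGrad f β c M₁ M₂ S₀ ε (fun i => Matrix.of (Q i ω)) k) =ᵐ[μ]
        fun ω => minGrad f β c M₁ M₂ S₀ ε (fun i => Matrix.of (Q' i ω)) k := by
      filter_upwards [ae_all_iff.2 hae] with ω hω
      simp only [hω]
    rwa [integrable_congr heq, integral_congr_ae heq]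
  have hg := continuous_gradient_of_lipschitz hL
  have hM := spectral_bounds_le (by omega) hS.lower hS.upper
  have hint := integrable_minGrad_pow (c := c) (ε := ε) (μ := μ) hf.continuous hg hβ.le hβ1.le hM
    hS hQ k 1
  simp only [pow_one] at hint
  refine ⟨hint, ?_⟩
  have hint2 := integrable_minGrad_pow (c := c) (ε := ε) (μ := μ) hf.continuous hg hβ.le hβ1.le hM
    hS hQ k 2
  set κ := decreaseConst C₀ C ϵ β c M₁ M₂ L n m d
  have hκ : 0 < κ := decreaseConst_pos hC.pos (by omega) hdn hL0 hβ hc hc2 hM₁ hM₂ h1 hp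
  set K := biasConst C ϵ c M₁ M₂ L n m d
  set G : Ω → ℝ := fun ω => minGrad f β c M₁ M₂ S₀ ε (fun i => Matrix.of (Q i ω)) k with hG
  set F : ℕ → ℝ := fun j =>
    ∫ ω, f (run f β c M₁ M₂ S₀ ε (fun i => Matrix.of (Q i ω)) j).x ∂μ with hF
  have hstep : ∀ j ∈ Finset.range (k + 1),
      κ * (∫ ω, G ω ^ 2 ∂μ - K ^ 2 * ε j ^ 2) ≤ F j - F (j + 1) := fun j hj =>
    expected_decrease hC hm hdn hf hL0 hL hb hβ hβ1 hc hc2 hM₁ hM₂ hS hQ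
      (fun i => (hlaw i).map_eq) hind h0 h1 hp hε (by have := Finset.mem_range.1 hj; omega)
  have hsum := Finset.sum_le_sum hstep
  rw [Finset.sum_range_sub', ← Finset.mul_sum, Finset.sum_sub_distrib, ← Finset.mul_sum] at hsum
  have hF0 : F 0 = f S₀.x := by simp [hF, run]
  have hFk : ⨅ x, f x ≤ F (k + 1) := by
    have e : ⨅ x, f x = ∫ _, ⨅ x, f x ∂μ := by simp
    rw [e]
    exact integral_mono (integrable_const _)
      (integrable_objective hf.continuous hb hβ.le hβ1.le hc.le hM₁.le hM hS hQ (k + 1))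
      fun ω => ciInf_le hb _
  simp only [Finset.sum_const, Finset.card_range, nsmul_eq_mul, Nat.cast_add, Nat.cast_one] at hsum
  have hk : (0 : ℝ) < k + 1 := by positivity
  refine Real.le_sqrt_of_sq_le ?_
  -- Jensen's inequality for the square, as nonnegativity of the variance.
  have hjensen : (∫ ω, G ω ∂μ) ^ 2 ≤ ∫ ω, G ω ^ 2 ∂μ := by
    have hv := variance_nonneg G μ
    rw [variance_eq_sub ((memLp_two_iff_integrable_sq hint.aestronglyMeasurable).2 hint2)] at hv
    simpa using hv
  refine hjensen.trans ?_
  have e1 : (k + 1) * ∫ ω, G ω ^ 2 ∂μ ≤ κ⁻¹ * (f S₀.x - ⨅ x, f x) +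
      K ^ 2 * ∑ j ∈ Finset.range (k + 1), ε j ^ 2 := by
    have : (k + 1) * ∫ ω, G ω ^ 2 ∂μ - K ^ 2 * ∑ j ∈ Finset.range (k + 1), ε j ^ 2 ≤
        κ⁻¹ * (f S₀.x - ⨅ x, f x) := by
      rw [le_inv_mul_iff₀ hκ]
      linarith
    linarith
  have e2 : 1 / ((k : ℝ) + 1) * κ⁻¹ * (f S₀.x - ⨅ x, f x) +
      K ^ 2 * (∑ j ∈ Finset.range (k + 1), ε j ^ 2) / ((k : ℝ) + 1) =
      (κ⁻¹ * (f S₀.x - ⨅ x, f x) + K ^ 2 * ∑ j ∈ Finset.range (k + 1), ε j ^ 2) /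
        ((k : ℝ) + 1) := by ring
  rw [e2, le_div_iff₀ hk]
  linarith

end Run

end SubspaceQN

/-! ### The theorem: constant and square-summable precisions. -/

theorem theorem5 :
    (∃ C₀ C : ℝ, SubspaceQN.IsGaussianConstants C₀ C) ∧
    ∀ C₀ C : ℝ, SubspaceQN.IsGaussianConstants C₀ C →
    ∀ (n m d : ℕ), 0 < m → Even m → d ≤ n →
    ∀ (f : SubspaceQN.Vec n → ℝ) (L : ℝ), ContDiff ℝ 2 f → 0 < L →
    (∀ u v, ‖gradient f u - gradient f v‖ ≤ L * ‖u - v‖) →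
    BddBelow (Set.range f) →
    ∀ (β c M₁ M₂ : ℝ), 0 < β → β < 1 → 0 < c → c < 1 / 2 → 0 < M₁ → 0 < M₂ →
    ∀ (x₀ : SubspaceQN.Vec n) (P₀ : Matrix (Fin n) (Fin m) ℝ) (H₀ : Matrix (Fin m) (Fin m) ℝ),
    (∀ j, ‖SubspaceQN.mulE P₀ (EuclideanSpace.single j 1)‖ = 1) →
    (H₀ - M₁ • (1 : Matrix (Fin m) (Fin m) ℝ)).PosSemidef →
    (M₂ • (1 : Matrix (Fin m) (Fin m) ℝ) - H₀).PosSemidef →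
    ∀ (Ω : Type*) [MeasurableSpace Ω] (μ : MeasureTheory.Measure Ω)
      [MeasureTheory.IsProbabilityMeasure μ] (Q : ℕ → Ω → Fin n → Fin d → ℝ),
    (∀ k, ProbabilityTheory.HasLaw (Q k) (SubspaceQN.gaussianMatrix n d) μ) →
    ProbabilityTheory.iIndepFun Q μ →
    ∀ ϵ : ℝ, 0 < ϵ → ϵ < 1 → 0 < SubspaceQN.successProb C₀ ϵ d →
    (∀ ε : ℝ, 0 < ε → ∀ k : ℕ,
      MeasureTheory.Integrable (fun ω => SubspaceQN.minGrad f β c M₁ M₂ ⟨x₀, P₀, H₀⟩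
        (fun _ => ε) (fun i => Matrix.of (Q i ω)) k) μ ∧
      ∫ ω, SubspaceQN.minGrad f β c M₁ M₂ ⟨x₀, P₀, H₀⟩
        (fun _ => ε) (fun i => Matrix.of (Q i ω)) k ∂μ ≤
      √(1 / ((k : ℝ) + 1) * (SubspaceQN.decreaseConst C₀ C ϵ β c M₁ M₂ L n m d)⁻¹ *
          (f x₀ - ⨅ x, f x) +
        SubspaceQN.biasConst C ϵ c M₁ M₂ L n m d ^ 2 * ε ^ 2)) ∧
    (∀ ε : ℕ → ℝ, (∀ k, 0 < ε k) → Summable (fun k => ε k ^ 2) →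
      (∀ k : ℕ,
        MeasureTheory.Integrable (fun ω => SubspaceQN.minGrad f β c M₁ M₂ ⟨x₀, P₀, H₀⟩
          ε (fun i => Matrix.of (Q i ω)) k) μ ∧
        ∫ ω, SubspaceQN.minGrad f β c M₁ M₂ ⟨x₀, P₀, H₀⟩
          ε (fun i => Matrix.of (Q i ω)) k ∂μ ≤
        √(1 / ((k : ℝ) + 1) * (SubspaceQN.decreaseConst C₀ C ϵ β c M₁ M₂ L n m d)⁻¹ *
            (f x₀ - ⨅ x, f x) +
          SubspaceQN.biasConst C ϵ c M₁ M₂ L n m d ^ 2 * (∑' i, ε i ^ 2) / ((k : ℝ) + 1))) ∧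
      (fun k : ℕ => ∫ ω, SubspaceQN.minGrad f β c M₁ M₂ ⟨x₀, P₀, H₀⟩
          ε (fun i => Matrix.of (Q i ω)) k ∂μ)
        =O[Filter.atTop] fun k : ℕ => √(1 / (k : ℝ))) := by
  refine ⟨⟨1 / 16, 108, SubspaceQN.isGaussianConstants⟩, ?_⟩
  intro C₀ C hC n m d hm0 hmeven hdn f L hf hL0 hL hb β c M₁ M₂ hβ hβ1 hc hc2 hM₁ hM₂ x₀ P₀ H₀
    hP₀ hH₁ hH₂ Ω _ μ _ Q hlaw hind ϵ h0 h1 hp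
  have hm : 2 ≤ m := by
    obtain ⟨r, rfl⟩ := hmeven
    omega
  have hS : SubspaceQN.State.Regular M₁ M₂ (⟨x₀, P₀, H₀⟩ : SubspaceQN.State n m) :=
    ⟨fun j => (hP₀ j).le, hH₁, hH₂⟩
  have main := fun (ε : ℕ → ℝ) (hε : ∀ k, 0 < ε k) (k : ℕ) =>
    SubspaceQN.expected_minGrad_le (ε := ε) hC hm hdn (hf.differentiable (by norm_num)) hL0 hL hb
      hβ hβ1 hc hc2 hM₁ hM₂ hS hlaw hind h0 h1 hp hε k
  have hκ : 0 < SubspaceQN.decreaseConst C₀ C ϵ β c M₁ M₂ L n m d :=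
    SubspaceQN.decreaseConst_pos hC.pos hm0 hdn hL0 hβ hc hc2 hM₁ hM₂ h1 hp
  have hf0 : 0 ≤ f x₀ - ⨅ x, f x := sub_nonneg.2 (ciInf_le hb x₀)
  refine ⟨fun ε hε k => ?_, fun ε hε hsum => ?_⟩
  · obtain ⟨hi, hle⟩ := main (fun _ => ε) (fun _ => hε) k
    refine ⟨hi, hle.trans (le_of_eq ?_)⟩
    have hk : (k : ℝ) + 1 ≠ 0 := by positivity
    congr 2
    simp only [Finset.sum_const, Finset.card_range, nsmul_eq_mul, Nat.cast_add, Nat.cast_one]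
    field_simp
  have bound : ∀ k : ℕ, MeasureTheory.Integrable (fun ω => SubspaceQN.minGrad f β c M₁ M₂
      ⟨x₀, P₀, H₀⟩ ε (fun i => Matrix.of (Q i ω)) k) μ ∧
      ∫ ω, SubspaceQN.minGrad f β c M₁ M₂ ⟨x₀, P₀, H₀⟩
        ε (fun i => Matrix.of (Q i ω)) k ∂μ ≤
      √(1 / ((k : ℝ) + 1) * (SubspaceQN.decreaseConst C₀ C ϵ β c M₁ M₂ L n m d)⁻¹ *
          (f x₀ - ⨅ x, f x) +
        SubspaceQN.biasConst C ϵ c M₁ M₂ L n m d ^ 2 * (∑' i, ε i ^ 2) / ((k : ℝ) + 1)) := by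
    intro k
    obtain ⟨hi, hle⟩ := main ε hε k
    refine ⟨hi, hle.trans (Real.sqrt_le_sqrt ?_)⟩
    have := hsum.sum_le_tsum (Finset.range (k + 1)) fun i _ => sq_nonneg _
    gcongr
  refine ⟨bound, ?_⟩
  set B := (SubspaceQN.decreaseConst C₀ C ϵ β c M₁ M₂ L n m d)⁻¹ * (f x₀ - ⨅ x, f x) +
    SubspaceQN.biasConst C ϵ c M₁ M₂ L n m d ^ 2 * ∑' i, ε i ^ 2 with hB
  have hB0 : 0 ≤ B := by
    have : 0 ≤ ∑' i, ε i ^ 2 := tsum_nonneg fun i => sq_nonneg _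
    positivity
  -- Starts at `k = 1`, because at `k = 0` the comparison function takes the value `√(1 / 0) = 0`.
  refine Asymptotics.IsBigO.of_bound (√B) (Filter.eventually_atTop.2 ⟨1, fun k hk => ?_⟩)
  have hk' : (0 : ℝ) < k := by exact_mod_cast hk
  rw [Real.norm_of_nonneg (MeasureTheory.integral_nonneg fun ω => SubspaceQN.minGrad_nonneg _ k),
    Real.norm_of_nonneg (Real.sqrt_nonneg _), ← Real.sqrt_mul hB0]
  refine (bound k).2.trans (Real.sqrt_le_sqrt ?_)
  calc _ = B * (1 / ((k : ℝ) + 1)) := by rw [hB]; ring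
    _ ≤ B * (1 / k) := by gcongr; linarith
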